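/- **Data.** Let $\Bbbk$ be a field with an automorphism $k\mapsto\overline k$ with $\overline{\overline k}=k$. *$\mathcal G$-LW data* consist of the following. 1. An abelian group $\mathcal G$ and a subset $\mathcal X\subset\mathcal G$ with $-\mathcal X=\mathcal X$ and $\mathcal G\not\subset Y+\mathcal X$ for every finite $Y\subset\mathcal G$; elements of $\mathcal G\setminus\mathcal X$ are called generic. For each generic $g$ a finite set $I_g$; put $\mathsf A=\bigsqcup_{g\notin\mathcal X} I_g$ and $|j|=g$ for $j\in I_g$. An involution $*$ on $\mathsf A$ with $I_g^*=I_{-g}$. 2. $\delta:\mathsf A^3\to\mathbb N$ with $\delta_{ijk}=\delta_{jki}=\delta_{k^*j^*i^*}$ and $\delta_{ijk}=0$ unless $|i|+|j|+|k|=0$. 3. Maps $\mathsf d,\mathsf b,\beta:\mathsf A\to\Bbbk^*$, invariant under $*$ and with values fixed by the bar, such that for all $g_1,g_2\notin\mathcal X$ and all $j\in\mathsf A$ with $|j|=g_1+g_2$, $\mathsf b(j)=\sum_{j_1\in I_{g_1},\,j_2\in I_{g_2}}\mathsf b(j_1)\mathsf b(j_2)\,\delta_{j^*j_1j_2}$.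 4. $\gamma:\mathsf A^3\times\mathbb N\to\Bbbk^*$ with $\overline\gamma=\gamma$, $\gamma^n_{i,j,k}=\gamma^n_{j,k,i}$ and $\gamma^n_{i,j,k}\gamma^n_{k^*,j^*,i^*}\beta(i)\beta(j)\beta(k)=1$ for $1\le n\le\delta_{ijk}$. 5. $N:\mathsf A^6\times\mathbb N^4\to\Bbbk$, where $N^{j_1j_2j_3}_{j_4j_5j_6}(^{a_1a_2}_{a_3a_4})=0$ unless $1\le a_1\le\delta_{j_1j_2j_3^*}$, $1\le a_2\le\delta_{j_3j_4j_5^*}$, $1\le a_3\le\delta_{j_5j_6^*j_1^*}$, $1\le a_4\le\delta_{j_6j_4^*j_2^*}$, such that (sums run over all labels giving nonzero terms, a finite set) $$N^{j_1 j_2 j_3}_{j_4 j_5 j_6}(^{a_1a_2}_{a_3a_4})= N^{j_2 j_3^*j_1^* }_{j_5 j_6j_4 }(^{a_1a_3}_{a_4a_2})= N^{j_3 j_4 j_5}_{j_6^* j_1 j_2^*}(^{a_2a_3}_{a_1a_4});$$ if $|j_2|+|j_3|\notin\mathcal X$, then $$\sum_{j,c_1,c_2,c_3}\mathsf d(j)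 N^{j_1 j_2 j_5}_{j_3 j_6 j}(^{a_1a_2}_{c_1c_2}) N^{j_1 j j_6}_{j_4 j_0 j_7}(^{c_1a_3}_{a_0c_3}) N^{j_2 j_3 j}_{j_4 j_7 j_8}(^{c_2c_3}_{a_4a_5})= \sum_{c_4}N^{j_5 j_3 j_6}_{j_4 j_0 j_8}(^{a_2a_3}_{c_4a_5}) N^{j_1 j_2 j_5}_{j_8 j_0 j_7}(^{a_1c_4}_{a_0a_4});$$ if $|j|+|l|\notin\mathcal X$, $1\le a_1\le\delta_{ijp^*}$ and $1\le a_2\le\delta_{plm^*}$, then $$\sum_{n,a_3,a_4}\mathsf d(n) N^{i j p}_{l m n}(^{a_1a_2}_{a_3a_4}) N^{k j^{*} i}_{n m l}(^{a'_1a_3}_{a'_2a_4}) = \frac{\delta_{k,p}\,\delta_{a_1,a'_1}\delta_{a_2,a'_2}}{\mathsf d(k)};$$ and $$\overline{N^{j_1 j_2 j_3 }_{j_4j_5j_6}(^{a_1a_2}_{a_3a_4})}= N^{j_2^{*} j_1^{*} j_3^{*}}_{j_5j_4j_6}(^{a_1a_2}_{a_4a_3})\,\gamma^{a_1}_{j_1,j_2,j_3^{*}}\gamma^{a_2}_{j_3,j_4,j_5^{*}}\gamma^{a_3}_{j_1^{*},j_5,j_6^{*}}\gamma^{a_4}_{j_2^{*},j_6,j_4^{*}}\prod_{i=1}^6\beta(j_i).$$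 **State space.** Let $\Sigma$ be a closed connected oriented surface with a (simplicial) triangulation, and $\Gamma$ the dual trivalent graph, whose vertices carry the cyclic order of their edges given by the orientation. Plaquettes are the components of $\Sigma\setminus\Gamma$, i.e. the vertices of the triangulation. A *$\mathcal G$-coloring* is a map $\Phi$ from oriented edges of $\Gamma$ to $\mathcal G$ with $\Phi(-e)=-\Phi(e)$ and $\Phi(e_1)+\Phi(e_2)+\Phi(e_3)=0$ for the three edges oriented towards any vertex; it is *admissible* if it takes only generic values. A *state* $\sigma$ of an admissible $\Phi$ assigns to each oriented edge $e$ some $\sigma(e)\in I_{\Phi(e)}$ with $\sigma(-e)=\sigma(e)^*$, and to each vertex $v$ an integer $0\le\sigma_0(v)\le\delta_{\sigma(e_1)\sigma(e_2)\sigma(e_3)}$, where $e_1,e_2,e_3$ are the cyclically ordered edges at $v$, oriented towards $v$. Let $\mathcal H(\Gamma,\Phi)$ be the $\Bbbk$-vector space with basis the states $|\Gamma,\sigma\rangle$, and define on it the form, semilinear in the first and linear in the second variable, with $$\langle\Gamma,\sigma\mid\Gamma,\sigma'\rangle=\delta_{\sigma,\sigma'}\,\frac{\prod_{v}\gamma^{\sigma_0(v)}_{\sigma(e_1),\sigma(e_2),\sigma(e_3)}\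 \prod_{e}\beta(\sigma(e))}{\prod_{e}\mathsf d(\sigma(e))}$$ (products over the vertices and the unoriented edges of $\Gamma$). **Plaquette operators.** For a plaquette $p$ and $g\in\mathcal G$ let $g.\delta p$ be the coloring equal to $g$ on the edges of $\partial p$ with the boundary orientation, $-g$ on their opposites, and $0$ on other edges. Let $\Phi$ and $\Phi+g.\delta p$ be admissible, $g$ generic and $s\in I_g$. Number the $n$ sides of $p$ cyclically along the direction opposite to the boundary orientation, and orient them in that direction; let $j_i$ be the label of the $i$-th side in $\sigma$, let $C_i$ be the label of the vertex between sides $i$ and $i+1$, and $k_i$ the label of the third edge at that vertex, oriented away from it (so the cyclically ordered inward labels there are $j_i,j_{i+1}^*,k_i^*$). Then $B_p^s:\mathcal H(\Gamma,\Phi)\to\mathcal H(\Gamma,\Phi+g.\delta p)$ is $$B_p^s|\Gamma,\sigma\rangle=\sum_{j'_i,\,A_i,\,C'_i}\ \prod_{i=1}^n\mathsf d(j'_i)\,N^{j'_i\,s\,j_i}_{j_{i+1}^*\,k_i\,j_{i+1}'^{*}}(^{A_i\,C_i}_{C'_i\,A_{i+1}})\ |\Gamma,\sigma'\rangle ,$$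 where $\sigma'$ is obtained from $\sigma$ by replacing $j_i,C_i$ by $j'_i,C'_i$. Put $B_p^g=\sum_{s\in I_g}\mathsf b(s)B_p^s$. If $\Phi$ is admissible, call $g$ *generic for $(\Phi,p)$* if $g\notin\mathcal X$ and $\Phi-g.\delta p$ is admissible; for such $g$ put $B_p=B_p^{g}B_p^{-g}:\mathcal H(\Gamma,\Phi)\to\mathcal H(\Gamma,\Phi-g.\delta p)\to\mathcal H(\Gamma,\Phi)$. **Theorem.** Let $\Phi$ be an admissible coloring. For every plaquette $p$ there is a $g$ that is generic for $(\Phi,p)$, and $B_p$ does not depend on the choice of such $g$. Moreover: 1. $B_p^2=B_p$ for every plaquette $p$; 2. $B_pB_{p'}=B_{p'}B_p$ for all plaquettes $p,p'$; 3. $\langle\psi\mid B_p\phi\rangle=\langle B_p\psi\mid\phi\rangle$ for every plaquette $p$ and all $\psi,\phi\in\mathcal H(\Gamma,\Phi)$. -/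

import Mathlib

open scoped Pointwise

/-! ## Algebraic input -/

/-- Generically graded labels: a small symmetric set `X` in an abelian group `G`, the disjoint
union `A` of the finite sets `I_g` indexed by the generic elements `g ∈ G ∖ X` (encoded by the
degree map `deg : A → G`), and an involution `dual` on `A` exchanging `I_g` and `I_{-g}`. -/
structure GradedLabels (G : Type*) [AddCommGroup G] where
  X : Set G
  X_symm : -X = X
  X_small : ∀ Y : Set G, Y.Finite → ¬ (Set.univ ⊆ Y + X)
  A : Type*
  deg : A → G
  deg_generic : ∀ a, deg a ∉ X
  finite_deg : ∀ g, {a | deg a = g}.Finite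
  dual : A → A
  dual_dual : ∀ a, dual (dual a) = a
  deg_dual : ∀ a, deg (dual a) = -deg a

namespace GradedLabels

variable {G : Type*} [AddCommGroup G] (L : GradedLabels G)

/-- The finite set `I_g` of labels of degree `g`. -/
noncomputable def I (g : G) : Finset L.A := (L.finite_deg g).toFinset

end GradedLabels

open Classical in
/-- `G`-LW data over a field `𝕜` whose involutive automorphism is `star`.

`N j₁ j₂ j₃ j₄ j₅ j₆ a₁ a₂ a₃ a₄` is the modified `6j` symbol with string labels `j₁ j₂ j₃` (top
row), `j₄ j₅ j₆` (bottom row) and branching labels `a₁ a₂` (top), `a₃ a₄` (bottom).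
A branching label at a vertex with inward labels `i, j, k` ranges over `1, …, δ i j k`.

In `pentagon` and `orthogonality` the summed string label has the degree forced by the support
of `N` (all other terms vanish); the identities are required when that degree is generic. -/
structure LWData (𝕜 : Type*) [Field 𝕜] [StarRing 𝕜] (G : Type*) [AddCommGroup G] extends
    GradedLabels G where
  /-- Fusion multiplicities. -/
  δ : A → A → A → ℕ
  δ_rotate : ∀ i j k, δ i j k = δ j k i
  δ_dual : ∀ i j k, δ i j k = δ (dual k) (dual j) (dual i)
  δ_deg : ∀ i j k, deg i + deg j + deg k ≠ 0 → δ i j k = 0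
  /-- Modified dimension. -/
  d : A → 𝕜
  d_ne_zero : ∀ i, d i ≠ 0
  star_d : ∀ i, star (d i) = d i
  d_dual : ∀ i, d (dual i) = d i
  b : A → 𝕜
  b_ne_zero : ∀ i, b i ≠ 0
  star_b : ∀ i, star (b i) = b i
  b_dual : ∀ i, b (dual i) = b i
  b_fusion : ∀ g₁ g₂ : G, g₁ ∉ X → g₂ ∉ X → ∀ j, deg j = g₁ + g₂ →
    b j = ∑ j₁ ∈ toGradedLabels.I g₁, ∑ j₂ ∈ toGradedLabels.I g₂,
      b j₁ * b j₂ * (δ (dual j) j₁ j₂ : 𝕜)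
  β : A → 𝕜
  β_ne_zero : ∀ i, β i ≠ 0
  star_β : ∀ i, star (β i) = β i
  β_dual : ∀ i, β (dual i) = β i
  γ : A → A → A → ℕ → 𝕜
  γ_ne_zero : ∀ i j k n, γ i j k n ≠ 0
  star_γ : ∀ i j k n, star (γ i j k n) = γ i j k n
  γ_rotate : ∀ i j k n, γ i j k n = γ j k i n
  γ_theta : ∀ i j k n, 1 ≤ n → n ≤ δ i j k →
    γ i j k n * γ (dual k) (dual j) (dual i) n * β i * β j * β k = 1
  /-- Modified `6j` symbols. -/
  N : A → A → A → A → A → A → ℕ → ℕ → ℕ → ℕ → 𝕜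
  N_support : ∀ j₁ j₂ j₃ j₄ j₅ j₆ a₁ a₂ a₃ a₄,
    ¬ ((1 ≤ a₁ ∧ a₁ ≤ δ j₁ j₂ (dual j₃)) ∧ (1 ≤ a₂ ∧ a₂ ≤ δ j₃ j₄ (dual j₅)) ∧
      (1 ≤ a₃ ∧ a₃ ≤ δ j₅ (dual j₆) (dual j₁)) ∧
      (1 ≤ a₄ ∧ a₄ ≤ δ j₆ (dual j₄) (dual j₂))) →
    N j₁ j₂ j₃ j₄ j₅ j₆ a₁ a₂ a₃ a₄ = 0
  N_symm₁ : ∀ j₁ j₂ j₃ j₄ j₅ j₆ a₁ a₂ a₃ a₄,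
    N j₁ j₂ j₃ j₄ j₅ j₆ a₁ a₂ a₃ a₄ = N j₂ (dual j₃) (dual j₁) j₅ j₆ j₄ a₁ a₃ a₄ a₂
  N_symm₂ : ∀ j₁ j₂ j₃ j₄ j₅ j₆ a₁ a₂ a₃ a₄,
    N j₁ j₂ j₃ j₄ j₅ j₆ a₁ a₂ a₃ a₄ = N j₃ j₄ j₅ (dual j₆) j₁ (dual j₂) a₂ a₃ a₁ a₄
  pentagon : ∀ j₀ j₁ j₂ j₃ j₄ j₅ j₆ j₇ j₈ a₀ a₁ a₂ a₃ a₄ a₅, deg j₂ + deg j₃ ∉ X →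
    (∑ j ∈ toGradedLabels.I (deg j₂ + deg j₃),
      ∑ c₁ ∈ Finset.Icc 1 (δ j₁ j (dual j₆)), ∑ c₂ ∈ Finset.Icc 1 (δ j₂ j₃ (dual j)),
      ∑ c₃ ∈ Finset.Icc 1 (δ j j₄ (dual j₇)),
        d j * N j₁ j₂ j₅ j₃ j₆ j a₁ a₂ c₁ c₂ * N j₁ j j₆ j₄ j₀ j₇ c₁ a₃ a₀ c₃ *
          N j₂ j₃ j j₄ j₇ j₈ c₂ c₃ a₄ a₅) =
    ∑ c₄ ∈ Finset.Icc 1 (δ j₅ j₈ (dual j₀)),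
      N j₅ j₃ j₆ j₄ j₀ j₈ a₂ a₃ c₄ a₅ * N j₁ j₂ j₅ j₈ j₀ j₇ a₁ c₄ a₀ a₄
  orthogonality : ∀ i j k l m p a₁ a₂ a₁' a₂', deg j + deg l ∉ X →
    (1 ≤ a₁ ∧ a₁ ≤ δ i j (dual p)) → (1 ≤ a₂ ∧ a₂ ≤ δ p l (dual m)) →
    ∑ n ∈ toGradedLabels.I (deg j + deg l), ∑ a₃ ∈ Finset.Icc 1 (δ i n (dual m)),
      ∑ a₄ ∈ Finset.Icc 1 (δ j l (dual n)),
        d n * N i j p l m n a₁ a₂ a₃ a₄ * N k (dual j) i n m l a₁' a₃ a₂' a₄ =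
      if k = p ∧ a₁ = a₁' ∧ a₂ = a₂' then 1 / d k else 0
  star_N : ∀ j₁ j₂ j₃ j₄ j₅ j₆ a₁ a₂ a₃ a₄,
    star (N j₁ j₂ j₃ j₄ j₅ j₆ a₁ a₂ a₃ a₄) =
      N (dual j₂) (dual j₁) (dual j₃) j₅ j₄ j₆ a₁ a₂ a₄ a₃ *
        γ j₁ j₂ (dual j₃) a₁ * γ j₃ j₄ (dual j₅) a₂ * γ (dual j₁) j₅ (dual j₆) a₃ *
        γ (dual j₂) j₆ (dual j₄) a₄ * (β j₁ * β j₂ * β j₃ * β j₄ * β j₅ * β j₆)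

/-! ## Triangulated surfaces and their dual graphs -/

/-- A triangulation, with vertex set `V`, of a closed connected oriented surface:
`tri a b c` says that `a, b, c` span a triangle and that their cyclic order is the positive one.
Each edge lies in exactly two triangles, which induce opposite orientations on it, and the link
of each vertex is a single cycle. -/
structure TriangulatedSurface (V : Type*) where
  tri : V → V → V → Prop
  tri_rotate : ∀ {a b c}, tri a b c → tri b c a
  tri_ne : ∀ {a b c}, tri a b c → a ≠ b
  /-- A set of three vertices spans at most one triangle, with one orientation. -/
  tri_not_swap : ∀ {a b c}, tri a b c → ¬ tri b a c
  tri_unique : ∀ {a b c c'}, tri a b c → tri a b c' → c = c'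
  tri_opposite : ∀ {a b c}, tri a b c → ∃ c', tri b a c'
  exists_tri : ∀ a, ∃ b c, tri a b c
  link_connected : ∀ {v b c b' c'}, tri v b c → tri v b' c' → Relation.ReflTransGen (tri v) b b'
  connected : ∀ v w, Relation.ReflTransGen (fun a b => ∃ c, tri a b c) v w
  nonempty : Nonempty V

namespace TriangulatedSurface

variable {V : Type*} (S : TriangulatedSurface V)

/-- The 1-skeleton of the triangulation. -/
def graph : SimpleGraph V where
  Adj a b := ∃ c, S.tri a b c
  symm := ⟨fun _ _ ⟨_, h⟩ => S.tri_opposite h⟩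
  loopless := ⟨fun _ ⟨_, h⟩ => S.tri_ne h rfl⟩

/-- Oriented edges of the dual graph `Γ`. The dart `(a, b)` of the 1-skeleton stands for the edge
of `Γ` crossing `ab`, oriented *towards* the (dual vertex of the) triangle `a b c` that is positively
oriented by `a, b, c`. So the edges at the dual vertex of `tri a b c`, oriented towards it, are
`(a, b)`, `(b, c)`, `(c, a)` in the cyclic order given by the orientation, and orientation reversal
of edges of `Γ` is `SimpleGraph.Dart.symm`. -/
abbrev OEdge : Type _ := S.graph.Dart

/-- Positively oriented triangles with a chosen first vertex. -/
abbrev Flag : Type _ := {x : V × V × V // S.tri x.1 x.2.1 x.2.2}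

/-- The first of the three edges of `Γ` at a trivalent vertex, oriented towards it. -/
def Flag.e₁ {S : TriangulatedSurface V} (f : S.Flag) : S.OEdge :=
  ⟨(f.1.1, f.1.2.1), ⟨_, f.2⟩⟩

/-- The second edge at the vertex. -/
def Flag.e₂ {S : TriangulatedSurface V} (f : S.Flag) : S.OEdge :=
  ⟨(f.1.2.1, f.1.2.2), ⟨_, S.tri_rotate f.2⟩⟩

/-- The third edge at the vertex. -/
def Flag.e₃ {S : TriangulatedSurface V} (f : S.Flag) : S.OEdge :=
  ⟨(f.1.2.2, f.1.1), ⟨_, S.tri_rotate (S.tri_rotate f.2)⟩⟩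

/-- Triangles, that is, vertices of `Γ`, as sets of three vertices of the triangulation. -/
abbrev Face [DecidableEq V] : Type _ :=
  {t : Finset V // ∃ f : S.Flag, ({f.1.1, f.1.2.1, f.1.2.2} : Finset V) = t}

/-- The triangle underlying a flag. -/
def Flag.face {S : TriangulatedSurface V} [DecidableEq V] (f : S.Flag) : S.Face :=
  ⟨{f.1.1, f.1.2.1, f.1.2.2}, f, rfl⟩

/-- A flag of a triangle; any other is obtained by rotating it. -/
noncomputable def Face.rep {S : TriangulatedSurface V} [DecidableEq V] (t : S.Face) : S.Flag :=
  t.2.choose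

/-- Unoriented edges of `Γ`. -/
abbrev UEdge : Type _ := {e : Sym2 V // e ∈ S.graph.edgeSet}

/-- An orientation of an edge of `Γ`. -/
noncomputable def UEdge.rep {S : TriangulatedSurface V} (e : S.UEdge) : S.OEdge :=
  ⟨(Quot.out e.1), by
    have h := e.2
    rw [← Quot.out_eq e.1] at h
    exact h⟩

/-- Sides of the plaquette dual to the vertex `p`: the vertices adjacent to `p`. -/
abbrev Side (p : V) : Type _ := {w : V // S.graph.Adj w p}

/-- The edge of `Γ` crossing `wp`, oriented against the boundary orientation of the plaquette
`p`. -/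
def Side.edge {S : TriangulatedSurface V} {p : V} (w : S.Side p) : S.OEdge := ⟨(w.1, p), w.2⟩

/-- Vertices of `Γ` on the boundary of the plaquette `p`: positively oriented triangles
`p, w, u`. -/
abbrev Corner (p : V) : Type _ := {x : V × V // S.tri p x.1 x.2}

section Corner

variable {S : TriangulatedSurface V} {p : V} (c : S.Corner p)

/-- For the corner `p, w, u`: the side `u`, the incoming one for the traversal of the boundary by
the edges `Side.edge`. -/
def Corner.sideIn : S.Side p := ⟨c.1.2, _, S.tri_rotate (S.tri_rotate c.2)⟩

/-- For the corner `p, w, u`: the side `w`, the outgoing one. -/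
def Corner.sideOut : S.Side p := ⟨c.1.1, S.tri_opposite c.2⟩

/-- For the corner `p, w, u`: the third edge of `Γ` at this vertex, oriented away from it. -/
def Corner.outer : S.OEdge := ⟨(c.1.2, c.1.1), S.tri_opposite (S.tri_rotate c.2)⟩

/-- The triangle at a corner. -/
def Corner.face [DecidableEq V] : S.Face := Flag.face ⟨(p, c.1.1, c.1.2), c.2⟩

end Corner

section Finiteness

variable [Fintype V]

instance : Finite S.OEdge := Finite.of_injective (fun e : S.OEdge => e.toProd)
  (SimpleGraph.Dart.toProd_injective)

noncomputable instance [DecidableEq V] : Fintype S.Face := Fintype.ofFinite _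
noncomputable instance : Fintype S.UEdge := Fintype.ofFinite _
noncomputable instance (p : V) : Fintype (S.Side p) := Fintype.ofFinite _
noncomputable instance (p : V) : Fintype (S.Corner p) := Fintype.ofFinite _
noncomputable instance (p : V) : DecidableEq (S.Side p) := Classical.decEq _

end Finiteness

/-! ## Colorings -/

/-- `G`-colorings of the dual graph. -/
@[ext]
structure Coloring (G : Type*) [AddCommGroup G] where
  val : S.OEdge → G
  val_symm : ∀ e, val e.symm = -val e
  val_vertex : ∀ f : S.Flag, val f.e₁ + val f.e₂ + val f.e₃ = 0

variable {S}

instance {G : Type*} [AddCommGroup G] : Add (S.Coloring G) where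
  add Φ Ψ :=
    { val := fun e => Φ.val e + Ψ.val e
      val_symm := fun e => by rw [Φ.val_symm, Ψ.val_symm]; abel
      val_vertex := fun f => by
        have h₁ := Φ.val_vertex f
        have h₂ := Ψ.val_vertex f
        calc _ = (Φ.val f.e₁ + Φ.val f.e₂ + Φ.val f.e₃) +
              (Ψ.val f.e₁ + Ψ.val f.e₂ + Ψ.val f.e₃) := by abel
          _ = 0 := by rw [h₁, h₂, add_zero] }

variable (S) in
/-- The coloring `g.δp`: it is `g` on the boundary edges `(p, w)` of the plaquette `p`, oriented
as the boundary of `p`, `-g` on their opposites `(w, p)`, and `0` on all other edges. -/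
def plaquetteColoring [DecidableEq V] {G : Type*} [AddCommGroup G] (g : G) (p : V) :
    S.Coloring G where
  val e := if e.fst = p then g else if e.snd = p then -g else 0
  val_symm e := by
    have := e.fst_ne_snd
    by_cases h₁ : e.fst = p <;> by_cases h₂ : e.snd = p <;> simp_all
  val_vertex f := by
    obtain ⟨⟨a, b, c⟩, h⟩ := f
    have h₁ : a ≠ b := S.tri_ne h
    have h₂ : b ≠ c := S.tri_ne (S.tri_rotate h)
    have h₃ : c ≠ a := S.tri_ne (S.tri_rotate (S.tri_rotate h))
    by_cases ha : a = p
    · subst ha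
      simp [Flag.e₁, Flag.e₂, Flag.e₃, h₁.symm, h₃]
    · by_cases hb : b = p
      · subst hb
        simp [Flag.e₁, Flag.e₂, Flag.e₃, h₁, h₂.symm]
      · by_cases hc : c = p
        · subst hc
          simp [Flag.e₁, Flag.e₂, Flag.e₃, h₂, h₃.symm]
        · simp [Flag.e₁, Flag.e₂, Flag.e₃, ha, hb, hc]

end TriangulatedSurface

/-! ## State spaces and operators -/

namespace LWData

open TriangulatedSurface

variable {𝕜 : Type*} [Field 𝕜] [StarRing 𝕜] {G : Type*} [AddCommGroup G] (D : LWData 𝕜 G)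
  {V : Type*} [DecidableEq V] {S : TriangulatedSurface V}

/-- A coloring is admissible if it takes only generic values. -/
def Admissible (Φ : S.Coloring G) : Prop := ∀ e, Φ.val e ∉ D.X

/-- States of a coloring. The value `vert t = 0` is the one that violates the branching rule. -/
@[ext]
structure State (Φ : S.Coloring G) where
  edge : S.OEdge → D.A
  vert : S.Face → ℕ
  deg_edge : ∀ e, D.deg (edge e) = Φ.val e
  edge_symm : ∀ e, edge e.symm = D.dual (edge e)
  vert_le : ∀ f : S.Flag, vert f.face ≤ D.δ (edge f.e₁) (edge f.e₂) (edge f.e₃)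

instance [Fintype V] (Φ : S.Coloring G) : Finite (D.State Φ) := by
  classical
  have hfin : ∀ g, Finite {a : D.A // D.deg a = g} := fun g => (D.finite_deg g).to_subtype
  let E := ∀ e : S.OEdge, {a : D.A // D.deg a = Φ.val e}
  have hE : Finite E := Pi.finite
  let F := Σ x : E, ∀ t : S.Face,
    Fin (D.δ (x t.rep.e₁).1 (x t.rep.e₂).1 (x t.rep.e₃).1 + 1)
  have hF : Finite F := inferInstance
  have hrep : ∀ t : S.Face, Flag.face t.rep = t := fun t => Subtype.ext t.2.choose_spec
  let φ : D.State Φ → F := fun σ => ⟨fun e => ⟨σ.edge e, σ.deg_edge e⟩, fun t =>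
    ⟨σ.vert t, by
      have h := σ.vert_le t.rep
      rw [hrep] at h
      exact Nat.lt_succ_of_le h⟩⟩
  refine Finite.of_injective φ fun σ τ h => ?_
  have h₁ : σ.edge = τ.edge := by
    have := (Sigma.mk.inj_iff.mp h).1
    funext e
    exact congrArg Subtype.val (congrFun this e)
  obtain ⟨e, v, _, _, _⟩ := σ
  obtain ⟨e', v', _, _, _⟩ := τ
  obtain rfl : e = e' := h₁
  have h₂ := eq_of_heq (Sigma.mk.inj_iff.mp h).2
  have h₃ : v = v' := by
    funext t
    exact congrArg Fin.val (congrFun h₂ t)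
  subst h₃
  rfl

noncomputable instance [Fintype V] (Φ : S.Coloring G) : Fintype (D.State Φ) := Fintype.ofFinite _

/-- The state space `H(Γ, Φ)`: vectors `∑ σ, ψ σ |Γ, σ⟩`. -/
abbrev StateSpace (Φ : S.Coloring G) : Type _ := D.State Φ → 𝕜

section Form

variable {D} {Φ : S.Coloring G}

/-- `γ(σ(v))`, computed from a flag of the triangle dual to `v`. -/
def State.flagγ (σ : D.State Φ) (f : S.Flag) : 𝕜 :=
  D.γ (σ.edge f.e₁) (σ.edge f.e₂) (σ.edge f.e₃) (σ.vert f.face)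

/-- `γ(σ(v))` does not depend on the flag. -/
theorem State.flagγ_eq (σ : D.State Φ) {f f' : S.Flag} (h : f.face = f'.face) :
    σ.flagγ f = σ.flagγ f' := by
  unfold State.flagγ
  rw [h]
  obtain ⟨⟨a, b, c⟩, hf⟩ := f
  obtain ⟨⟨a', b', c'⟩, hf'⟩ := f'
  have h₁ : a ≠ b := S.tri_ne hf
  have h₂ : b ≠ c := S.tri_ne (S.tri_rotate hf)
  have h₃ : c ≠ a := S.tri_ne (S.tri_rotate (S.tri_rotate hf))
  have h₁' : a' ≠ b' := S.tri_ne hf'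
  have h₂' : b' ≠ c' := S.tri_ne (S.tri_rotate hf')
  have h₃' : c' ≠ a' := S.tri_ne (S.tri_rotate (S.tri_rotate hf'))
  have hset : ({a, b, c} : Finset V) = {a', b', c'} := congrArg Subtype.val h
  have ha : a' ∈ ({a, b, c} : Finset V) := by rw [hset]; simp
  have hb : b' ∈ ({a, b, c} : Finset V) := by rw [hset]; simp
  have hc : c' ∈ ({a, b, c} : Finset V) := by rw [hset]; simp
  simp only [Finset.mem_insert, Finset.mem_singleton] at ha hb hc
  rcases ha with rfl | rfl | rfl <;> rcases hb with rfl | rfl | rfl <;>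
    rcases hc with rfl | rfl | rfl <;>
    first
    | exact absurd rfl h₁'
    | exact absurd rfl h₂'
    | exact absurd rfl h₃'
    | rfl
    | exact D.γ_rotate _ _ _ _
    | exact (D.γ_rotate _ _ _ _).symm
    | exact absurd (S.tri_rotate hf') (S.tri_not_swap hf)
    | exact absurd (S.tri_rotate (S.tri_rotate hf')) (S.tri_not_swap hf)
    | exact absurd hf' (S.tri_not_swap hf)

variable [Fintype V]

/-- The norm of `|Γ, σ⟩`: `∏_v γ(σ(v)) ∏_e β(σ(e)) / ∏_e d(σ(e))`. It does not depend on the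
chosen representatives, because `γ` is invariant by rotation and `β`, `d` by duality. -/
noncomputable def State.weight (σ : D.State Φ) : 𝕜 :=
  (∏ v : S.Face, σ.flagγ v.rep) * (∏ e : S.UEdge, D.β (σ.edge e.rep)) /
    ∏ e : S.UEdge, D.d (σ.edge e.rep)

variable (D) in
/-- The indefinite inner product on `H(Γ, Φ)`. -/
noncomputable def form (ψ φ : D.StateSpace Φ) : 𝕜 :=
  ∑ σ : D.State Φ, star (ψ σ) * σ.weight * φ σ

end Form

/-- `σ` and `σ'` agree on all edges that are not sides of the plaquette `p` and on all vertices of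
`Γ` that do not lie on the boundary of `p`. -/
def AgreeOff (p : V) {Φ Φ' : S.Coloring G} (σ : D.State Φ) (σ' : D.State Φ') : Prop :=
  (∀ e : S.OEdge, e.fst ≠ p → e.snd ≠ p → σ'.edge e = σ.edge e) ∧
    ∀ t : S.Face, p ∉ t.1 → σ'.vert t = σ.vert t

variable [Fintype V]

open Classical in
/-- The coefficient of `|Γ, σ'⟩` in `B_p^s |Γ, σ⟩`. With the sides numbered `1, …, n` along the
edges `Side.edge`, with labels `j_i` in `σ` and `j'_i` in `σ'`, and with outer labels `k_i` and
vertex labels `C_i`, `C'_i`, it is the sum over `1 ≤ A_i ≤ δ(j'_i, s, j_i*)` of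
`∏ i, d(j'_i) N^{j'_i s j_i}_{j_{i+1}* k_i j'_{i+1}*}(A_i C_i; C'_i A_{i+1})`. -/
noncomputable def stringCoeff (p : V) (s : D.A) {Φ Φ' : S.Coloring G} (σ' : D.State Φ')
    (σ : D.State Φ) : 𝕜 :=
  if D.AgreeOff p σ σ' then
    ∑ a ∈ Fintype.piFinset fun w : S.Side p =>
        Finset.Icc 1 (D.δ (σ'.edge w.edge) s (D.dual (σ.edge w.edge))),
      ∏ c : S.Corner p,
        D.d (σ'.edge c.sideIn.edge) *
          D.N (σ'.edge c.sideIn.edge) s (σ.edge c.sideIn.edge)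
            (D.dual (σ.edge c.sideOut.edge)) (σ.edge c.outer) (D.dual (σ'.edge c.sideOut.edge))
            (a c.sideIn) (σ.vert c.face) (σ'.vert c.face) (a c.sideOut)
  else 0

/-- The operator `B_p^s : H(Γ, Φ) → H(Γ, Φ')`, used for `Φ' = Φ + g.δp`, `s ∈ I_g`. -/
noncomputable def stringOp (p : V) (s : D.A) (Φ Φ' : S.Coloring G) :
    D.StateSpace Φ →ₗ[𝕜] D.StateSpace Φ' :=
  Matrix.mulVecLin (Matrix.of fun σ' σ => D.stringCoeff p s σ' σ)

/-- The operator `B_p^g : H(Γ, Φ) → H(Γ, Φ')`, used for `Φ' = Φ + g.δp`. -/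
noncomputable def gradedPlaquetteOp (p : V) (g : G) (Φ Φ' : S.Coloring G) :
    D.StateSpace Φ →ₗ[𝕜] D.StateSpace Φ' :=
  ∑ s ∈ D.I g, D.b s • D.stringOp p s Φ Φ'

/-- The values `g` for which `B_p^g B_p^{-g}` is defined on `H(Γ, Φ)`: `g` is generic and
`Φ - g.δp` is admissible. -/
def GenericAt (Φ : S.Coloring G) (p : V) (g : G) : Prop :=
  g ∉ D.X ∧ D.Admissible (Φ + S.plaquetteColoring (-g) p)

/-- The plaquette operator `B_p = B_p^g B_p^{-g}` on `H(Γ, Φ)`, computed with `g`. -/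
noncomputable def plaquetteOp (Φ : S.Coloring G) (p : V) (g : G) : Module.End 𝕜 (D.StateSpace Φ) :=
  D.gradedPlaquetteOp p g (Φ + S.plaquetteColoring (-g) p) Φ ∘ₗ
    D.gradedPlaquetteOp p (-g) Φ (Φ + S.plaquetteColoring (-g) p)

end LWData

/-!
Expand `B_p^s` over the corners and sides of `p`: its matrix entries are cyclic sums (*loop sums*),
one summation index per side and one factor `d N` per corner. In a product `B_p^{s₁} B_p^{s₂}` the
pentagon identity rewrites the two factors at a corner as a sum over a label `s`, and the
orthogonality relation along each side forces the labels chosen at its two ends to agree. Hence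
`B_p^{s₁} B_p^{s₂} = ∑ s, δ s₁ s₂ s* • B_p^s`, and the relation on `b` turns this into
`B_p^{g₁} B_p^{g₂} = B_p^{g₁ + g₂}`. Inserting an auxiliary degree generic for everything in sight
yields both the independence of `B_p^g B_p^{-g}` of `g` and its idempotence.

Operators at plaquettes without a common side commute because they act on disjoint parts of a state
and see only unchanged labels of each other. If `p` and `q` share sides, the two corners at the
ends of each common side carry one factor of `B_p` and one of `B_q`; the pentagon identity,
together with the symmetries of `N`, exchanges the order in which the two act.

For the adjoint, conjugating `N` produces factors `γ` at the vertices, which the weights of the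
states absorb, and factors at the sides, each of which occurs at both ends of its side and cancels
around the loop. Thus `B_p^{s}` is adjoint to `B_p^{s*}`.
-/

namespace GradedLabels

variable {G : Type*} [AddCommGroup G] (L : GradedLabels G)

@[simp]
theorem mem_I {g : G} {a : L.A} : a ∈ L.I g ↔ L.deg a = g := by
  simp [I]

theorem neg_mem_X_iff {x : G} : -x ∈ L.X ↔ x ∈ L.X := by
  conv_rhs => rw [← L.X_symm]
  exact Set.mem_neg.symm

theorem exists_forall_sub_notMem {Y : Set G} (hY : Y.Finite) : ∃ g, ∀ y ∈ Y, g - y ∉ L.X := by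
  by_contra! h
  refine L.X_small Y hY fun g _ => ?_
  obtain ⟨y, hy, hg⟩ := h g
  exact ⟨y, hy, g - y, hg, by simp⟩

end GradedLabels

namespace TriangulatedSurface

variable {V : Type*} {S : TriangulatedSurface V}

section Corner

variable {p : V}

theorem Corner.sideIn_bijective :
    Function.Bijective (Corner.sideIn : S.Corner p → S.Side p) := by
  constructor
  · rintro ⟨⟨w, u⟩, h⟩ ⟨⟨w', u'⟩, h'⟩ heq
    obtain rfl : u = u' := congrArg Subtype.val heq
    obtain rfl : w = w' := S.tri_unique (S.tri_rotate (S.tri_rotate h))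
      (S.tri_rotate (S.tri_rotate h'))
    rfl
  · rintro ⟨u, c, h⟩
    exact ⟨⟨(c, u), S.tri_rotate h⟩, rfl⟩

theorem Corner.sideOut_bijective :
    Function.Bijective (Corner.sideOut : S.Corner p → S.Side p) := by
  constructor
  · rintro ⟨⟨w, u⟩, h⟩ ⟨⟨w', u'⟩, h'⟩ heq
    obtain rfl : w = w' := congrArg Subtype.val heq
    obtain rfl : u = u' := S.tri_unique h h'
    rfl
  · rintro ⟨w, h⟩
    obtain ⟨c, hc⟩ := S.tri_opposite h.choose_spec
    exact ⟨⟨(w, c), hc⟩, rfl⟩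

variable (S p) in
/-- The bijection between the corners and the sides of a plaquette sending a corner to its
incoming side. -/
noncomputable def inEquiv : S.Corner p ≃ S.Side p := .ofBijective _ Corner.sideIn_bijective

variable (S p) in
/-- The bijection between the corners and the sides of a plaquette sending a corner to its
outgoing side. -/
noncomputable def outEquiv : S.Corner p ≃ S.Side p := .ofBijective _ Corner.sideOut_bijective

theorem Side.nonempty (S : TriangulatedSurface V) (p : V) : Nonempty (S.Side p) := by
  obtain ⟨b, c, h⟩ := S.exists_tri p
  exact ⟨⟨c, _, S.tri_rotate (S.tri_rotate h)⟩⟩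

theorem Side.eq_of_forall_corner {T : Type*} {f : S.Side p → T}
    (hf : ∀ c : S.Corner p, f c.sideOut = f c.sideIn) (w w' : S.Side p) : f w = f w' := by
  obtain ⟨⟨⟨b, c⟩, h⟩, rfl⟩ := Corner.sideOut_bijective.2 w
  obtain ⟨⟨⟨b', c'⟩, h'⟩, rfl⟩ := Corner.sideOut_bijective.2 w'
  have eq_of_linked : ∀ x, Relation.ReflTransGen (S.tri p) b x → ∀ hx : S.graph.Adj x p,
      f (Corner.sideOut ⟨(b, c), h⟩) = f ⟨x, hx⟩ := by
    intro x hx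
    induction hx with
    | refl => exact fun _ => rfl
    | @tail y z _ hyz ih =>
      exact fun hz => (ih (S.tri_opposite hyz)).trans (hf ⟨(y, z), hyz⟩)
  exact eq_of_linked b' (S.link_connected h h') _

theorem Side.edge_injective : Function.Injective (Side.edge : S.Side p → S.OEdge) := fun _ _ h =>
  Subtype.ext (congrArg (fun e : S.OEdge => e.fst) h)

theorem Side.edge_ne_symm (w w' : S.Side p) : w.edge ≠ w'.edge.symm := fun h =>
  w.2.ne (congrArg (fun e : S.OEdge => e.fst) h)

end Corner

/-- The edge `e` of `Γ` lies on the boundary of the plaquette `p`. -/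
def OnBoundary (p : V) (e : S.OEdge) : Prop := e.fst = p ∨ e.snd = p

theorem onBoundary_symm {p : V} {e : S.OEdge} : OnBoundary p e.symm ↔ OnBoundary p e := or_comm

theorem Side.onBoundary {p : V} (w : S.Side p) : OnBoundary p w.edge := .inr rfl

theorem OnBoundary.exists_side {p : V} {e : S.OEdge} (h : OnBoundary p e) :
    ∃ w : S.Side p, w.edge = e ∨ w.edge.symm = e := by
  obtain ⟨⟨a, b⟩, hab⟩ := e
  rcases h with rfl | rfl
  · exact ⟨⟨b, hab.symm⟩, .inr rfl⟩
  · exact ⟨⟨a, hab⟩, .inl rfl⟩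

theorem Corner.not_onBoundary_outer {p : V} (c : S.Corner p) : ¬ OnBoundary p c.outer := by
  rintro (h | h)
  · exact c.sideIn.2.ne h
  · exact c.sideOut.2.ne h

section Face

/-- The same triangle with its second vertex chosen as the first one. -/
def Flag.rotate (f : S.Flag) : S.Flag := ⟨(f.1.2.1, f.1.2.2, f.1.1), S.tri_rotate f.2⟩

variable [DecidableEq V]

theorem Flag.face_rotate (f : S.Flag) : f.rotate.face = f.face := by
  refine Subtype.ext (Finset.ext fun t => ?_)
  simp only [Flag.face, Flag.rotate, Finset.mem_insert, Finset.mem_singleton]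
  tauto

theorem Flag.eq_or_eq_rotate_of_face_eq {f f' : S.Flag} (h : f.face = f'.face) :
    f' = f ∨ f' = f.rotate ∨ f' = f.rotate.rotate := by
  obtain ⟨⟨a, b, c⟩, hf⟩ := f
  obtain ⟨⟨a', b', c'⟩, hf'⟩ := f'
  have hab' : a' ≠ b' := S.tri_ne hf'
  have hbc' : b' ≠ c' := S.tri_ne (S.tri_rotate hf')
  have hca' : c' ≠ a' := S.tri_ne (S.tri_rotate (S.tri_rotate hf'))
  have not_swap : ¬ S.tri b a c := S.tri_not_swap hf
  have rotate_mem := S.tri_rotate hf'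
  have rotate_rotate_mem := S.tri_rotate (S.tri_rotate hf')
  have hset : ({a, b, c} : Finset V) = {a', b', c'} := congrArg Subtype.val h
  have ha : a' ∈ ({a, b, c} : Finset V) := by simp [hset]
  have hb : b' ∈ ({a, b, c} : Finset V) := by simp [hset]
  have hc : c' ∈ ({a, b, c} : Finset V) := by simp [hset]
  simp only [Finset.mem_insert, Finset.mem_singleton] at ha hb hc
  rcases ha with rfl | rfl | rfl <;> rcases hb with rfl | rfl | rfl <;>
    rcases hc with rfl | rfl | rfl <;> simp_all [Flag.rotate]

theorem Flag.eq_of_face_eq {T : Type*} {F : S.Flag → T} (hF : ∀ f, F f.rotate = F f)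
    {f f' : S.Flag} (h : f.face = f'.face) : F f = F f' := by
  obtain rfl | rfl | rfl := Flag.eq_or_eq_rotate_of_face_eq h
  · rfl
  · exact (hF f).symm
  · exact ((hF f.rotate).trans (hF f)).symm

theorem Face.rep_face (t : S.Face) : t.rep.face = t := Subtype.ext t.2.choose_spec

omit [DecidableEq V] in
theorem UEdge.edge_rep (e : S.UEdge) : e.rep.edge = e.1 := Quot.out_eq e.1

theorem Face.exists_flag (t : S.Face) : ∃ f : S.Flag, f.face = t := ⟨t.rep, t.rep_face⟩

/-- The triangle at a corner, with the plaquette as its first vertex. -/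
def Corner.flag {p : V} (c : S.Corner p) : S.Flag := ⟨(p, c.1.1, c.1.2), c.2⟩

theorem Corner.mem_face {p : V} (c : S.Corner p) : p ∈ c.face.1 := by
  simp [Corner.face, Flag.face]

theorem Corner.face_injective {p : V} : Function.Injective fun c : S.Corner p => c.flag.face := by
  intro c c' h
  have hw : p ≠ c.1.1 := S.tri_ne c.2
  have hu : p ≠ c.1.2 := c.sideIn.2.ne.symm
  have fst_eq (e : c'.flag = c.flag.rotate ∨ c'.flag = c.flag.rotate.rotate) : False := by
    rcases e with e | e
    exacts [hw (congrArg (·.1.1) e), hu (congrArg (·.1.1) e)]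
  have e := (Flag.eq_or_eq_rotate_of_face_eq h).resolve_right fst_eq
  exact Subtype.ext (congrArg (·.1.2) e).symm

theorem Face.exists_corner {p : V} {t : S.Face} (h : p ∈ t.1) : ∃ c : S.Corner p, c.face = t := by
  obtain ⟨f, rfl⟩ := t.exists_flag
  simp only [Flag.face, Finset.mem_insert, Finset.mem_singleton] at h
  rcases h with rfl | rfl | rfl
  · exact ⟨⟨f.1.2, f.2⟩, rfl⟩
  · exact ⟨⟨f.rotate.1.2, f.rotate.2⟩, f.face_rotate⟩
  · exact ⟨⟨f.rotate.rotate.1.2, f.rotate.rotate.2⟩, f.rotate.face_rotate.trans f.face_rotate⟩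

end Face

section Coloring

variable {G : Type*} [AddCommGroup G]

theorem Coloring.add_val (Φ Ψ : S.Coloring G) (e : S.OEdge) :
    (Φ + Ψ).val e = Φ.val e + Ψ.val e := rfl

variable [DecidableEq V] {g g' : G} {p q : V} {Φ Φ' : S.Coloring G}

theorem plaquetteColoring_add_val (e : S.OEdge) : (S.plaquetteColoring (g + g') p).val e =
    (S.plaquetteColoring g p).val e + (S.plaquetteColoring g' p).val e := by
  simp only [plaquetteColoring]
  split_ifs <;> simp only [neg_add, add_zero]

theorem add_plaquetteColoring_add : Φ + S.plaquetteColoring g p + S.plaquetteColoring g' p =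
    Φ + S.plaquetteColoring (g + g') p := by
  ext e
  simp only [Coloring.add_val, plaquetteColoring_add_val, add_assoc]

theorem add_plaquetteColoring_zero : Φ + S.plaquetteColoring 0 p = Φ := by
  ext e
  simp only [Coloring.add_val, plaquetteColoring, neg_zero, ite_self, add_zero]

theorem add_plaquetteColoring_comm : Φ + S.plaquetteColoring g p + S.plaquetteColoring g' q =
    Φ + S.plaquetteColoring g' q + S.plaquetteColoring g p := by
  ext e
  simp only [Coloring.add_val, add_right_comm]

theorem add_plaquetteColoring_neg_add :
    Φ + S.plaquetteColoring (-g) p + S.plaquetteColoring g p = Φ := by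
  rw [add_plaquetteColoring_add, neg_add_cancel, add_plaquetteColoring_zero]

theorem Side.val_edge_of_eq_add (w : S.Side p) (h : Φ' = Φ + S.plaquetteColoring g p) :
    Φ'.val w.edge = Φ.val w.edge - g := by
  rw [h, Coloring.add_val]
  simp [plaquetteColoring, Side.edge, w.2.ne, sub_eq_add_neg]

theorem val_eq_of_not_onBoundary {e : S.OEdge} (he : ¬ OnBoundary p e)
    (h : Φ' = Φ + S.plaquetteColoring g p) : Φ'.val e = Φ.val e := by
  obtain ⟨h₁, h₂⟩ := not_or.mp he
  simp [h, Coloring.add_val, plaquetteColoring, h₁, h₂]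

end Coloring

section Patch

variable [DecidableEq V] {ι κ : Type*}

variable (S) in
/-- A set of edges and of vertices of `Γ` whose labels are to be varied, with an orientation of
each of the edges and a flag of each of the vertices. It contains both ends of its edges. -/
structure Patch (ι κ : Type*) where
  edge : ι → S.OEdge
  flag : κ → S.Flag
  edge_injective : Function.Injective edge
  edge_ne_symm : ∀ i i', edge i ≠ (edge i').symm
  face_injective : Function.Injective fun k => (flag k).face
  exists_face_eq : ∀ i (f : S.Flag), edge i = f.e₁ ∨ (edge i).symm = f.e₁ →
    ∃ k, (flag k).face = f.face

namespace Patch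

variable (P : S.Patch ι κ)

/-- The edge `e` of `Γ` is not in the patch. -/
def AvoidsEdge (e : S.OEdge) : Prop := ∀ i, P.edge i ≠ e ∧ (P.edge i).symm ≠ e

/-- The vertex `t` of `Γ` is not in the patch. -/
def AvoidsFace (t : S.Face) : Prop := ∀ k, (P.flag k).face ≠ t

theorem edge_cases (e : S.OEdge) :
    (∃ i, P.edge i = e) ∨ (∃ i, (P.edge i).symm = e) ∨ P.AvoidsEdge e := by
  simp only [AvoidsEdge, forall_and, ne_eq, ← not_exists]
  tauto

theorem face_cases (t : S.Face) : (∃ k, (P.flag k).face = t) ∨ P.AvoidsFace t := by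
  simp only [AvoidsFace, ne_eq, ← not_exists]
  tauto

theorem symm_injective : Function.Injective fun i => (P.edge i).symm :=
  SimpleGraph.Dart.symm_involutive.injective.comp P.edge_injective

variable {P}

theorem AvoidsEdge.symm {e : S.OEdge} (h : P.AvoidsEdge e) : P.AvoidsEdge e.symm := fun i =>
  ⟨fun hi => (h i).2 (by rw [hi, SimpleGraph.Dart.symm_symm]),
    fun hi => (h i).1 (SimpleGraph.Dart.symm_involutive.injective hi)⟩

theorem AvoidsFace.avoidsEdge {f : S.Flag} (h : P.AvoidsFace f.face) : P.AvoidsEdge f.e₁ := by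
  refine fun i => not_or.mp fun hi => ?_
  obtain ⟨k, hk⟩ := P.exists_face_eq i f hi
  exact h k hk

theorem AvoidsFace.rotate {f : S.Flag} (h : P.AvoidsFace f.face) : P.AvoidsFace f.rotate.face := by
  rwa [f.face_rotate]

end Patch

end Patch

end TriangulatedSurface

namespace LWData

open TriangulatedSurface

variable {𝕜 : Type*} [Field 𝕜] [StarRing 𝕜] {G : Type*} [AddCommGroup G] (D : LWData 𝕜 G)
  {V : Type*} [DecidableEq V] {S : TriangulatedSurface V}

theorem Admissible.genericAt {D : LWData 𝕜 G} {Φ : S.Coloring G} (hΦ : D.Admissible Φ) (p : V)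
    {g : G} (hg : g ∉ D.X) (h : ∀ e, g - Φ.val e ∉ D.X) : D.GenericAt Φ p g := by
  refine ⟨hg, fun e => ?_⟩
  simp only [Coloring.add_val, plaquetteColoring]
  split_ifs
  · rw [← D.neg_mem_X_iff, neg_add_rev, neg_neg, ← sub_eq_add_neg]
    exact h e
  · have := h e.symm
    rwa [Φ.val_symm, sub_neg_eq_add, ← neg_neg g, add_comm] at this
  · rw [add_zero]
    exact hΦ e

theorem exists_genericAt [Finite V] {Φ Ψ : S.Coloring G} (hΦ : D.Admissible Φ)
    (hΨ : D.Admissible Ψ) (p : V) {Y : Set G} (hY : Y.Finite) :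
    ∃ g, D.GenericAt Φ p g ∧ D.GenericAt Ψ p g ∧ ∀ y ∈ Y, g - y ∉ D.X := by
  cases nonempty_fintype V
  have values_finite (Θ : S.Coloring G) : (Set.range Θ.val).Finite := Set.finite_range _
  obtain ⟨g, hg⟩ := D.exists_forall_sub_notMem
    (((values_finite Φ).union (values_finite Ψ)).union (hY.insert 0))
  have hg₀ : g ∉ D.X := by simpa using hg 0 (by simp)
  exact ⟨g, hΦ.genericAt p hg₀ fun e => hg _ (by simp), hΨ.genericAt p hg₀ fun e => hg _ (by simp),
    fun y hy => hg y (by simp [hy])⟩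

section Labeling

variable (S) in
/-- Labels on the oriented edges and on the vertices of `Γ`, subject to no condition. Changing the
labels of a state on a patch gives such a labeling, which may violate the branching rules. -/
@[ext]
structure Labeling where
  edge : S.OEdge → D.A
  vert : S.Face → ℕ

/-- The multiplicity `δ` of the three labels around the vertex of a flag. -/
def mult (E : S.OEdge → D.A) (f : S.Flag) : ℕ := D.δ (E f.e₁) (E f.e₂) (E f.e₃)

variable {D} {Φ : S.Coloring G} {ι κ : Type*}

theorem mult_eq_of_face_eq (E : S.OEdge → D.A) {f f' : S.Flag} (h : f.face = f'.face) :
    D.mult E f = D.mult E f' :=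
  Flag.eq_of_face_eq (F := D.mult E) (fun _ => (D.δ_rotate _ _ _).symm) h

/-- The labeling underlying a state. -/
def State.toLabeling (σ : D.State Φ) : D.Labeling S := ⟨σ.edge, σ.vert⟩

theorem State.toLabeling_injective :
    Function.Injective (State.toLabeling : D.State Φ → D.Labeling S) := fun _ _ h =>
  State.ext (congrArg Labeling.edge h) (congrArg Labeling.vert h)

/-- Relabel the edges of a patch by `j`. -/
noncomputable def relabelEdge (P : S.Patch ι κ) (E : S.OEdge → D.A) (j : ι → D.A) :
    S.OEdge → D.A :=
  Function.extend P.edge j (Function.extend (fun i => (P.edge i).symm) (fun i => D.dual (j i)) E)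

/-- Relabel the edges of a patch by `j` and its vertices by `C`. -/
noncomputable def Labeling.relabel (B : D.Labeling S) (P : S.Patch ι κ) (j : ι → D.A) (C : κ → ℕ) :
    D.Labeling S where
  edge := relabelEdge P B.edge j
  vert := Function.extend (fun k => (P.flag k).face) C B.vert

variable (P : S.Patch ι κ) (E : S.OEdge → D.A) (B : D.Labeling S) (j : ι → D.A) (C : κ → ℕ)

theorem relabelEdge_apply (i : ι) : relabelEdge P E j (P.edge i) = j i :=
  P.edge_injective.extend_apply _ _ _

theorem relabelEdge_symm (i : ι) : relabelEdge P E j (P.edge i).symm = D.dual (j i) := by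
  rw [relabelEdge, Function.extend_apply' _ _ _ fun ⟨i', h⟩ => P.edge_ne_symm _ _ h]
  exact P.symm_injective.extend_apply _ _ _

variable {P} in
theorem relabelEdge_of_avoids {e : S.OEdge} (h : P.AvoidsEdge e) : relabelEdge P E j e = E e := by
  rw [relabelEdge, Function.extend_apply' _ _ _ fun ⟨i, hi⟩ => (h i).1 hi,
    Function.extend_apply' _ _ _ fun ⟨i, hi⟩ => (h i).2 hi]

variable {P E} in
theorem mult_eq_of_avoidsFace {E' : S.OEdge → D.A} (h : ∀ e, P.AvoidsEdge e → E e = E' e)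
    {f : S.Flag} (hf : P.AvoidsFace f.face) : D.mult E f = D.mult E' f := by
  have h₁ := h f.e₁ hf.avoidsEdge
  have h₂ := h f.e₂ hf.rotate.avoidsEdge
  have h₃ := h f.e₃ hf.rotate.rotate.avoidsEdge
  rw [mult, mult, h₁, h₂, h₃]

theorem Labeling.relabel_vert_apply (k : κ) : (B.relabel P j C).vert (P.flag k).face = C k :=
  P.face_injective.extend_apply _ _ _

variable {P} in
theorem Labeling.relabel_vert_of_avoids {t : S.Face} (h : P.AvoidsFace t) :
    (B.relabel P j C).vert t = B.vert t :=
  Function.extend_apply' _ _ _ fun ⟨k, hk⟩ => h k hk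

/-- Equality of labelings on all edges and vertices which are not in the patch. -/
structure Labeling.EqOff (P : S.Patch ι κ) (L B : D.Labeling S) : Prop where
  edge : ∀ e, P.AvoidsEdge e → L.edge e = B.edge e
  vert : ∀ t, P.AvoidsFace t → L.vert t = B.vert t

@[refl]
theorem Labeling.EqOff.refl : B.EqOff P B := ⟨fun _ _ => rfl, fun _ _ => rfl⟩

variable {P B} in
theorem Labeling.EqOff.symm {L : D.Labeling S} (h : L.EqOff P B) : B.EqOff P L :=
  ⟨fun e he => (h.edge e he).symm, fun t ht => (h.vert t ht).symm⟩

theorem Labeling.relabel_eqOff : (B.relabel P j C).EqOff P B :=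
  ⟨fun _ => relabelEdge_of_avoids B.edge j, fun _ => B.relabel_vert_of_avoids j C⟩

variable {P B} in
theorem State.relabel_toLabeling {σ : D.State Φ} (h : σ.toLabeling.EqOff P B) :
    B.relabel P (fun i => σ.edge (P.edge i)) (fun k => σ.vert (P.flag k).face) =
      σ.toLabeling := by
  refine Labeling.ext (funext fun e => ?_) (funext fun t => ?_)
  · obtain ⟨i, rfl⟩ | ⟨i, rfl⟩ | he := P.edge_cases e
    · exact relabelEdge_apply P _ _ i
    · exact (relabelEdge_symm P _ _ i).trans (σ.edge_symm _).symm
    · exact (relabelEdge_of_avoids _ _ he).trans (h.edge e he).symm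
  · obtain ⟨k, rfl⟩ | ht := P.face_cases t
    · exact B.relabel_vert_apply P _ _ k
    · exact (B.relabel_vert_of_avoids _ _ ht).trans (h.vert t ht).symm

/-- The labeling `B` satisfies the conditions for a state of `Φ` outside the patch. -/
structure Labeling.IsStateOff (P : S.Patch ι κ) (Φ : S.Coloring G) (B : D.Labeling S) : Prop where
  deg_edge : ∀ e, P.AvoidsEdge e → D.deg (B.edge e) = Φ.val e
  edge_symm : ∀ e, P.AvoidsEdge e → B.edge e.symm = D.dual (B.edge e)
  vert_le : ∀ f : S.Flag, P.AvoidsFace f.face → B.vert f.face ≤ D.mult B.edge f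

variable {P B j C} in
theorem Labeling.IsStateOff.exists_state (hB : B.IsStateOff P Φ)
    (hj : ∀ i, D.deg (j i) = Φ.val (P.edge i))
    (hC : ∀ k, C k ≤ D.mult (relabelEdge P B.edge j) (P.flag k)) :
    ∃ σ : D.State Φ, σ.toLabeling = B.relabel P j C := by
  refine ⟨⟨relabelEdge P B.edge j, (B.relabel P j C).vert, fun e => ?_, fun e => ?_,
    fun f => ?_⟩, rfl⟩
  · obtain ⟨i, rfl⟩ | ⟨i, rfl⟩ | he := P.edge_cases e
    · rw [relabelEdge_apply, hj]
    · rw [relabelEdge_symm, D.deg_dual, hj, Φ.val_symm]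
    · rw [relabelEdge_of_avoids _ _ he, hB.deg_edge e he]
  · obtain ⟨i, rfl⟩ | ⟨i, rfl⟩ | he := P.edge_cases e
    · rw [relabelEdge_apply, relabelEdge_symm]
    · rw [relabelEdge_symm, D.dual_dual, SimpleGraph.Dart.symm_symm, relabelEdge_apply]
    · rw [relabelEdge_of_avoids _ _ he, relabelEdge_of_avoids _ _ he.symm, hB.edge_symm e he]
  · obtain ⟨k, hk⟩ | hf := P.face_cases f.face
    · rw [← hk, relabel_vert_apply]
      exact (hC k).trans (mult_eq_of_face_eq _ hk).le
    · rw [relabel_vert_of_avoids _ _ _ hf]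
      exact (hB.vert_le f hf).trans
        (mult_eq_of_avoidsFace (fun _ => relabelEdge_of_avoids _ _) hf).ge

open Finset in
theorem sum_state_eq_sum_relabel [Fintype V] [Fintype ι] [DecidableEq ι] [Fintype κ]
    [DecidableEq κ] {R : Type*} [AddCommMonoid R] {P : S.Patch ι κ} {B : D.Labeling S}
    (hB : B.IsStateOff P Φ) (F : D.Labeling S → R)
    (hF : ∀ σ : D.State Φ, F σ.toLabeling ≠ 0 →
      σ.toLabeling.EqOff P B ∧ ∀ k, σ.vert (P.flag k).face ≠ 0) :
    ∑ σ : D.State Φ, F σ.toLabeling =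
      ∑ j ∈ Fintype.piFinset fun i => D.I (Φ.val (P.edge i)),
        ∑ C ∈ Fintype.piFinset fun k => Icc 1 (D.mult (relabelEdge P B.edge j) (P.flag k)),
          F (B.relabel P j C) := by
  have restrict_eq (σ : D.State Φ) (hσ : F σ.toLabeling ≠ 0) :=
    State.relabel_toLabeling (hF σ hσ).1
  rw [sum_sigma']
  refine sum_bij_ne_zero
    (fun σ _ _ => ⟨fun i => σ.edge (P.edge i), fun k => σ.vert (P.flag k).face⟩) ?_ ?_ ?_ ?_
  · intro σ _ hσ
    simp only [mem_sigma, Fintype.mem_piFinset, GradedLabels.mem_I, mem_Icc]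
    have edge_eq : relabelEdge P B.edge (fun i => σ.edge (P.edge i)) = σ.edge :=
      congrArg Labeling.edge (restrict_eq σ hσ)
    rw [edge_eq]
    exact ⟨fun i => σ.deg_edge _, fun k =>
      ⟨Nat.one_le_iff_ne_zero.mpr ((hF σ hσ).2 k), σ.vert_le _⟩⟩
  · intro σ _ hσ τ _ hτ h
    simp only [Sigma.mk.injEq, heq_eq_eq] at h
    refine State.toLabeling_injective ((restrict_eq σ hσ).symm.trans ?_)
    rw [h.1, h.2, restrict_eq τ hτ]
  · rintro ⟨j, C⟩ hjC hne
    simp only [mem_sigma, Fintype.mem_piFinset, GradedLabels.mem_I, mem_Icc] at hjC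
    obtain ⟨σ, hσ⟩ := hB.exists_state hjC.1 fun k => (hjC.2 k).2
    have edge_eq := congrArg Labeling.edge hσ
    have vert_eq := congrArg Labeling.vert hσ
    refine ⟨σ, mem_univ _, hσ ▸ hne,
      Sigma.ext (funext fun i => ?_) (heq_of_eq (funext fun k => ?_))⟩
    · exact (congrFun edge_eq _).trans (relabelEdge_apply P _ j i)
    · exact (congrFun vert_eq _).trans (B.relabel_vert_apply P j C k)
  · exact fun σ _ hσ => congrArg F (restrict_eq σ hσ).symm

end Labeling

section LoopSum

open Finset

variable {R W K α β γ : Type*} [CommSemiring R] [Fintype W] [DecidableEq W] [Fintype K]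

/-- The trace of a product of transfer matrices `F k` around closed loops with sides `W` and
corners `K`, the corner `k` leading from the side `inn k` to the side `out k`. The indices at the
side `w` run through `A w`. -/
def loopSum (inn out : K → W) (A : W → Finset α) (F : K → α → α → R) : R :=
  ∑ a ∈ Fintype.piFinset A, ∏ k, F k (a (inn k)) (a (out k))

theorem sum_piFinset_sigma {M : Type*} [AddCommMonoid M] (J : W → Finset α)
    (A : W → α → Finset β) (F : (W → α) → (W → β) → M) :
    ∑ j ∈ Fintype.piFinset J, ∑ a ∈ Fintype.piFinset fun w => A w (j w), F j a =
      ∑ y ∈ Fintype.piFinset fun w => (J w).sigma (A w),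
        F (fun w => (y w).1) (fun w => (y w).2) := by
  rw [sum_sigma']
  refine sum_nbij' (fun x w => ⟨x.1 w, x.2 w⟩) (fun y => ⟨fun w => (y w).1, fun w => (y w).2⟩)
    ?_ ?_ (fun _ _ => rfl) (fun _ _ => rfl) (fun _ _ => rfl)
  · simp only [mem_sigma, Fintype.mem_piFinset]
    exact fun _ hx w => ⟨hx.1 w, hx.2 w⟩
  · simp only [mem_sigma, Fintype.mem_piFinset]
    exact fun _ hy => ⟨fun w => (hy w).1, fun w => (hy w).2⟩

theorem sum_loopSum_mul_loopSum [DecidableEq K] (inn out : K → W) (J : W → Finset α)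
    (Q : K → α → α → Finset γ) (A B : W → α → Finset β) (F F' : K → α → α → γ → β → β → R) :
    ∑ j ∈ Fintype.piFinset J, ∑ C ∈ Fintype.piFinset fun k => Q k (j (inn k)) (j (out k)),
      loopSum inn out (fun w => A w (j w)) (fun k => F k (j (inn k)) (j (out k)) (C k)) *
        loopSum inn out (fun w => B w (j w)) (fun k => F' k (j (inn k)) (j (out k)) (C k)) =
    loopSum inn out (fun w => (J w).sigma fun j => (A w j).sigma fun _ => B w j)
      fun k y y' => ∑ C ∈ Q k y.1 y'.1,
        F k y.1 y'.1 C y.2.1 y'.2.1 * F' k y.1 y'.1 C y.2.2 y'.2.2 := by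
  simp only [loopSum]
  rw [← sum_piFinset_sigma J (fun w j => (A w j).sigma fun _ => B w j)
    fun j (y : W → Σ _ : β, β) => ∏ k, ∑ C ∈ Q k (j (inn k)) (j (out k)),
      F k (j (inn k)) (j (out k)) C (y (inn k)).1 (y (out k)).1 *
        F' k (j (inn k)) (j (out k)) C (y (inn k)).2 (y (out k)).2]
  refine sum_congr rfl fun j _ => ?_
  rw [← sum_piFinset_sigma (fun w => A w (j w)) (fun w _ => B w (j w)) fun a b =>
    ∏ k, ∑ C ∈ Q k (j (inn k)) (j (out k)),
      F k (j (inn k)) (j (out k)) C (a (inn k)) (a (out k)) *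
        F' k (j (inn k)) (j (out k)) C (b (inn k)) (b (out k))]
  simp only [sum_mul_sum, ← prod_mul_distrib, prod_univ_sum]
  rw [sum_comm]
  exact sum_congr rfl fun a _ => sum_comm

theorem loopSum_sum_mul [DecidableEq K] (inn out : K ≃ W) (Y : W → Finset α) (Z : K → Finset β)
    (f : K → α → β → R) (g : K → β → α → R) :
    loopSum inn out Y (fun k y y' => ∑ z ∈ Z k, f k y z * g k z y') =
      ∑ z ∈ Fintype.piFinset Z, ∏ w, ∑ y ∈ Y w,
        g (out.symm w) (z (out.symm w)) y * f (inn.symm w) y (z (inn.symm w)) := by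
  simp only [loopSum, prod_univ_sum]
  rw [sum_comm]
  refine sum_congr rfl fun z _ => sum_congr rfl fun y _ => ?_
  rw [prod_mul_distrib, prod_mul_distrib, mul_comm, ← out.prod_comp, ← inn.prod_comp]
  simp only [Equiv.symm_apply_apply]

open Classical in
theorem sum_ite_matching_eq_sum_loopSum [DecidableEq K] [Nonempty W] (inn out : K ≃ W)
    (hconn : ∀ f : W → β, (∀ k, f (out k) = f (inn k)) → ∀ w w', f w = f w')
    (T : Finset β) (A : β → W → Finset α) (F : K → β → α → α → R) :
    ∑ z ∈ Fintype.piFinset fun k => T.sigma fun t => A t (inn k) ×ˢ A t (out k),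
      (if ∀ w, (z (out.symm w)).1 = (z (inn.symm w)).1 ∧
          (z (out.symm w)).2.2 = (z (inn.symm w)).2.1 then
        ∏ k, F k (z k).1 (z k).2.1 (z k).2.2 else 0) =
    ∑ t ∈ T, loopSum inn out (A t) (fun k => F k t) := by
  simp only [loopSum, sum_sigma']
  obtain ⟨w₀⟩ := ‹Nonempty W›
  symm
  refine sum_of_injOn (fun x k => ⟨x.1, x.2 (inn k), x.2 (out k)⟩) ?_ ?_ ?_ ?_
  · rintro ⟨t, a⟩ _ ⟨t', a'⟩ _ h
    have h (w : W) := congrFun h (inn.symm w)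
    simp only [Sigma.mk.injEq, heq_eq_eq, Prod.mk.injEq, Equiv.apply_symm_apply] at h
    obtain rfl : a = a' := funext fun w => (h w).2.1
    rw [(h w₀).1]
  · rintro ⟨t, a⟩ h
    simp only [coe_sigma, Set.mem_sigma_iff, mem_coe, Fintype.mem_piFinset] at h
    simp only [mem_coe, Fintype.mem_piFinset, mem_sigma, mem_product]
    exact fun k => ⟨h.1, h.2 _, h.2 _⟩
  · intro z hz z_notMem_image
    refine if_neg fun matching => z_notMem_image ?_
    simp only [Fintype.mem_piFinset, mem_sigma, mem_product] at hz
    have fst_const (k : K) : (z k).1 = (z (inn.symm w₀)).1 := by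
      have := hconn (fun w => (z (inn.symm w)).1)
        (fun k => by simpa only [Equiv.symm_apply_apply] using (matching (out k)).1.symm) (inn k) w₀
      simpa only [Equiv.symm_apply_apply] using this
    refine ⟨⟨(z (inn.symm w₀)).1, fun w => (z (inn.symm w)).2.1⟩, ?_, funext fun k => ?_⟩
    · simp only [coe_sigma, Set.mem_sigma_iff, mem_coe, Fintype.mem_piFinset]
      refine ⟨(hz _).1, fun w => ?_⟩
      simpa only [fst_const (inn.symm w), Equiv.apply_symm_apply] using (hz (inn.symm w)).2.1
    · have snd_eq := (matching (out k)).2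
      simp only [Equiv.symm_apply_apply] at snd_eq ⊢
      rw [← fst_const k, ← snd_eq]
  · rintro ⟨t, a⟩ _
    simp only [Equiv.apply_symm_apply, and_self, implies_true, if_true]

open Classical in
/-- Cutting every corner along labels `t ∈ T` opens the loop into arcs around the sides; where the
sum over a side forces the labels of its arc to agree, a loop labelled by a single `t` remains. -/
theorem loopSum_eq_sum_loopSum [Nonempty W] (inn out : K ≃ W)
    (hconn : ∀ f : W → β, (∀ k, f (out k) = f (inn k)) → ∀ w w', f w = f w')
    {Y : W → Finset γ} {H : K → γ → γ → R} {T : Finset β} {A : β → W → Finset α}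
    {F : K → β → α → α → R} (f : K → γ → (Σ _ : β, α × α) → R) (g : K → (Σ _ : β, α × α) → γ → R)
    (hcorner : ∀ k y y', H k y y' =
      ∑ z ∈ T.sigma fun t => A t (inn k) ×ˢ A t (out k), f k y z * g k z y')
    (hside : ∀ z : K → Σ _ : β, α × α,
      (∀ k, z k ∈ T.sigma fun t => A t (inn k) ×ˢ A t (out k)) → ∀ w,
      ∑ y ∈ Y w, g (out.symm w) (z (out.symm w)) y * f (inn.symm w) y (z (inn.symm w)) =
        if (z (out.symm w)).1 = (z (inn.symm w)).1 ∧ (z (out.symm w)).2.2 = (z (inn.symm w)).2.1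
        then F (out.symm w) (z (out.symm w)).1 (z (out.symm w)).2.1 (z (out.symm w)).2.2
        else 0) :
    loopSum inn out Y H = ∑ t ∈ T, loopSum inn out (A t) (fun k => F k t) := by
  obtain rfl : H = fun k y y' => ∑ z ∈ _, f k y z * g k z y' :=
    funext fun k => funext fun y => funext fun y' => hcorner k y y'
  rw [loopSum_sum_mul, ← sum_ite_matching_eq_sum_loopSum inn out hconn]
  refine sum_congr rfl fun z hz => ?_
  rw [prod_congr rfl fun w _ => hside z (Fintype.mem_piFinset.mp hz) w]
  simp only [prod_ite_zero, mem_univ, true_implies]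
  rw [out.symm.prod_comp fun k => F k (z k).1 (z k).2.1 (z k).2.2]

end LoopSum

section Fusion

open Finset

variable {D}

theorem sum_I_dual {M : Type*} [AddCommMonoid M] (g : G) (f : D.A → M) :
    ∑ n ∈ D.I (-g), f n = ∑ j ∈ D.I g, f (D.dual j) :=
  sum_nbij' D.dual D.dual (by simp +contextual [D.deg_dual]) (by simp +contextual [D.deg_dual])
    (by simp [D.dual_dual]) (by simp [D.dual_dual]) (by simp [D.dual_dual])

variable (D) in
/-- The factor of `stringCoeff` at a vertex of `Γ`: `i, o` are the labels of the incoming and of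
the outgoing side, `C` is the label of the vertex and `a, a'` are the indices of summation at the
two sides. Primes on `i, o, C` refer to the new state. -/
def cornerCoeff (outer s i' o' i o : D.A) (C' C a a' : ℕ) : 𝕜 :=
  D.d i' * D.N i' s i (D.dual o) outer (D.dual o') a C C' a'

theorem sum_cornerCoeff_mul_cornerCoeff {s₁ s₂ : D.A} (hX : D.deg s₁ + D.deg s₂ ∉ D.X)
    (outer i₂ o₂ i o i₀ o₀ : D.A) (C₂ C₀ a a' b b' : ℕ) :
    ∑ C ∈ Icc 1 (D.δ i (D.dual o) (D.dual outer)),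
      D.cornerCoeff outer s₁ i₂ o₂ i o C₂ C a a' * D.cornerCoeff outer s₂ i o i₀ o₀ C C₀ b b' =
    ∑ s ∈ D.I (D.deg s₁ + D.deg s₂), ∑ c ∈ Icc 1 (D.δ s₁ s₂ (D.dual s)),
      ∑ x ∈ Icc 1 (D.δ i₂ s (D.dual i₀)), ∑ x' ∈ Icc 1 (D.δ o₂ s (D.dual o₀)),
        D.d i * D.N i₂ s₁ i s₂ i₀ s a b x c *
          (D.d s * D.cornerCoeff outer s i₂ o₂ i₀ o₀ C₂ C₀ x x' *
            D.N s₁ s₂ s (D.dual o₀) (D.dual o₂) (D.dual o) c x' a' b') := by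
  have δ_out (s : D.A) : D.δ o₂ s (D.dual o₀) = D.δ s (D.dual o₀) (D.dual (D.dual o₂)) := by
    rw [D.δ_rotate, D.dual_dual]
  have pentagon := D.pentagon outer i₂ s₁ s₂ (D.dual o₀) i i₀ (D.dual o₂) (D.dual o) C₂ a b C₀ a' b'
    hX
  calc
    _ = D.d i₂ * D.d i * ∑ C ∈ Icc 1 (D.δ i (D.dual o) (D.dual outer)),
          D.N i s₂ i₀ (D.dual o₀) outer (D.dual o) b C₀ C b' *
            D.N i₂ s₁ i (D.dual o) outer (D.dual o₂) a C C₂ a' := by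
      rw [mul_sum]
      exact sum_congr rfl fun C _ => by simp only [cornerCoeff]; ring
    _ = _ := by
      rw [← pentagon, mul_sum]
      refine sum_congr rfl fun s _ => ?_
      rw [sum_comm, mul_sum]
      refine sum_congr rfl fun c _ => ?_
      rw [mul_sum, δ_out]
      refine sum_congr rfl fun x _ => ?_
      rw [mul_sum]
      exact sum_congr rfl fun x' _ => by simp only [cornerCoeff]; ring

open Classical in
theorem sum_N_mul_N_eq_ite {s₁ s₂ s s' i i₂ : D.A} {c x c' x' : ℕ}
    (hX : D.deg i - D.deg s₂ ∉ D.X) (hc : c ∈ Icc 1 (D.δ s₁ s₂ (D.dual s)))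
    (hx : x ∈ Icc 1 (D.δ i₂ s (D.dual i))) :
    ∑ j ∈ D.I (D.deg i - D.deg s₂), ∑ a ∈ Icc 1 (D.δ i₂ s₁ (D.dual j)),
      ∑ b ∈ Icc 1 (D.δ j s₂ (D.dual i)),
        D.N s₁ s₂ s (D.dual i) (D.dual i₂) (D.dual j) c x a b *
          (D.d j * D.N i₂ s₁ j s₂ i s' a b x' c') =
      if s = s' ∧ c = c' ∧ x = x' then 1 / D.d s else 0 := by
  have hdeg : D.deg s₂ + D.deg (D.dual i) = -(D.deg i - D.deg s₂) := by
    rw [D.deg_dual]; abel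
  have δ_dual_left (j k : D.A) : D.δ i₂ j (D.dual k) = D.δ j (D.dual k) (D.dual (D.dual i₂)) := by
    rw [D.δ_rotate, D.dual_dual]
  have δ_dual_right (j : D.A) :
      D.δ j s₂ (D.dual i) = D.δ s₂ (D.dual i) (D.dual (D.dual j)) := by
    rw [D.δ_rotate, D.dual_dual]
  have orthogonality := D.orthogonality s₁ s₂ s' (D.dual i) (D.dual i₂) s c x c' x'
    (by rwa [hdeg, D.neg_mem_X_iff]) (mem_Icc.mp hc) (mem_Icc.mp (δ_dual_left s i ▸ hx))
  rw [hdeg, sum_I_dual] at orthogonality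
  have swap_if : (if s = s' ∧ c = c' ∧ x = x' then 1 / D.d s else 0) =
      if s' = s ∧ c = c' ∧ x = x' then 1 / D.d s' else 0 := by
    by_cases h : s' = s
    · rw [h]
    · rw [if_neg fun h' => h h'.1.symm, if_neg fun h' => h h'.1]
  rw [swap_if, ← orthogonality]
  refine sum_congr rfl fun j _ => ?_
  rw [δ_dual_left, δ_dual_right]
  refine sum_congr rfl fun a _ => sum_congr rfl fun b _ => ?_
  rw [D.d_dual, D.N_symm₂ s', D.N_symm₁ s₁ (D.dual j), D.N_symm₁ (D.dual j)]
  simp only [D.dual_dual]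
  ring

variable {W K : Type*} [Fintype W] [DecidableEq W] [Fintype K]

variable (D) in
/-- The coefficient of `B_p^s` for the plaquette with sides `W` and corners `K`, as a function of
the labels `j` of the sides and `C` of the vertices before, and `j'` and `C'` after. -/
def loopCoeff (inn out : K → W) (outer : K → D.A) (s : D.A) (j' j : W → D.A) (C' C : K → ℕ) : 𝕜 :=
  loopSum inn out (fun w => Icc 1 (D.δ (j' w) s (D.dual (j w)))) fun k =>
    D.cornerCoeff (outer k) s (j' (inn k)) (j' (out k)) (j (inn k)) (j (out k)) (C' k) (C k)

open Classical in
theorem sum_loopCoeff_mul_loopCoeff [DecidableEq K] [Nonempty W] (inn out : K ≃ W)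
    (hconn : ∀ f : W → Σ _ : D.A, ℕ, (∀ k, f (out k) = f (inn k)) → ∀ w w', f w = f w')
    {s₁ s₂ : D.A} (hX : D.deg s₁ + D.deg s₂ ∉ D.X) (outer : K → D.A) {j₂ j₀ : W → D.A}
    (hj₀ : ∀ w, D.deg (j₀ w) - D.deg s₂ ∉ D.X) (C₂ C₀ : K → ℕ) :
    ∑ j ∈ Fintype.piFinset fun w => D.I (D.deg (j₀ w) - D.deg s₂),
      ∑ C ∈ Fintype.piFinset fun k =>
          Icc 1 (D.δ (j (inn k)) (D.dual (j (out k))) (D.dual (outer k))),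
        D.loopCoeff inn out outer s₁ j₂ j C₂ C * D.loopCoeff inn out outer s₂ j j₀ C C₀ =
    ∑ s ∈ D.I (D.deg s₁ + D.deg s₂),
      (D.δ s₁ s₂ (D.dual s) : 𝕜) * D.loopCoeff inn out outer s j₂ j₀ C₂ C₀ := by
  -- The pentagon identity cuts the string at every corner into the fusion of `s₁` and `s₂` to some
  -- `s`; orthogonality at the sides then glues these `s` to one string around the loop.
  let T : Finset (Σ _ : D.A, ℕ) :=
    (D.I (D.deg s₁ + D.deg s₂)).sigma fun s => Icc 1 (D.δ s₁ s₂ (D.dual s))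
  let A (t : Σ _ : D.A, ℕ) (w : W) : Finset ℕ := Icc 1 (D.δ (j₂ w) t.1 (D.dual (j₀ w)))
  let F (k : K) (t : Σ _ : D.A, ℕ) : ℕ → ℕ → 𝕜 := D.cornerCoeff (outer k) t.1 (j₂ (inn k))
    (j₂ (out k)) (j₀ (inn k)) (j₀ (out k)) (C₂ k) (C₀ k)
  let f (k : K) (y : Σ _ : D.A, Σ _ : ℕ, ℕ) (z : Σ _ : (Σ _ : D.A, ℕ), ℕ × ℕ) : 𝕜 :=
    D.d y.1 * D.N (j₂ (inn k)) s₁ y.1 s₂ (j₀ (inn k)) z.1.1 y.2.1 y.2.2 z.2.1 z.1.2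
  let g (k : K) (z : Σ _ : (Σ _ : D.A, ℕ), ℕ × ℕ) (y : Σ _ : D.A, Σ _ : ℕ, ℕ) : 𝕜 :=
    D.d z.1.1 * F k z.1 z.2.1 z.2.2 * D.N s₁ s₂ z.1.1 (D.dual (j₀ (out k))) (D.dual (j₂ (out k)))
      (D.dual y.1) z.1.2 z.2.2 y.2.1 y.2.2
  simp only [loopCoeff]
  rw [sum_loopSum_mul_loopSum inn out (fun w => D.I (D.deg (j₀ w) - D.deg s₂))
    (fun k i o => Icc 1 (D.δ i (D.dual o) (D.dual (outer k))))
    (fun w j => Icc 1 (D.δ (j₂ w) s₁ (D.dual j))) (fun w j => Icc 1 (D.δ j s₂ (D.dual (j₀ w))))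
    (fun k i o C a a' => D.cornerCoeff (outer k) s₁ (j₂ (inn k)) (j₂ (out k)) i o (C₂ k) C a a')
    (fun k i o C b b' => D.cornerCoeff (outer k) s₂ i o (j₀ (inn k)) (j₀ (out k)) C (C₀ k) b b'),
    loopSum_eq_sum_loopSum inn out hconn (T := T) (A := A) (F := F) f g]
  · simp only [T, A, F, sum_sigma, sum_const, Nat.card_Icc, Nat.add_sub_cancel, nsmul_eq_mul]
  · intro k y y'
    rw [sum_cornerCoeff_mul_cornerCoeff hX]
    simp only [T, sum_sigma, sum_product]
    rfl
  · intro z hz w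
    have hzw := mem_sigma.mp (hz (out.symm w))
    rw [Equiv.apply_symm_apply, mem_product] at hzw
    simp only [sum_sigma, f, g, Equiv.apply_symm_apply, mul_assoc, ← mul_sum]
    rw [sum_N_mul_N_eq_ite (hj₀ w) (mem_sigma.mp hzw.1).2 hzw.2.2]
    simp only [Sigma.ext_iff, heq_eq_eq, and_assoc, mul_ite, mul_zero]
    congr 1
    field_simp [D.d_ne_zero]

end Fusion

section PlaquettePatch

variable {p : V}

variable (S p) in
/-- The patch of the sides and the corners of a plaquette, on which `B_p^s` acts. -/
def plaquettePatch : S.Patch (S.Side p) (S.Corner p) where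
  edge := Side.edge
  flag := Corner.flag
  edge_injective := Side.edge_injective
  edge_ne_symm := Side.edge_ne_symm
  face_injective := Corner.face_injective
  exists_face_eq w f h := by
    have hf : OnBoundary p f.e₁ := by
      rcases h with h | h
      · exact h ▸ w.onBoundary
      · exact h ▸ onBoundary_symm.mpr w.onBoundary
    refine Face.exists_corner ?_
    rcases hf with hf | hf <;> simp [Flag.face, ← hf, Flag.e₁]

theorem plaquettePatch_avoidsEdge {e : S.OEdge} :
    (plaquettePatch S p).AvoidsEdge e ↔ ¬ OnBoundary p e := by
  refine ⟨fun h he => ?_, fun he w => ⟨fun h => ?_, fun h => ?_⟩⟩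
  · obtain ⟨w, hw | hw⟩ := he.exists_side
    exacts [(h w).1 hw, (h w).2 hw]
  · exact he (h ▸ w.onBoundary)
  · exact he (h ▸ onBoundary_symm.mpr w.onBoundary)

theorem plaquettePatch_avoidsFace {t : S.Face} :
    (plaquettePatch S p).AvoidsFace t ↔ p ∉ t.1 := by
  refine ⟨fun h ht => ?_, fun ht c h => ht (h ▸ c.mem_face)⟩
  obtain ⟨c, hc⟩ := Face.exists_corner ht
  exact h c hc

variable {D} {Φ Φ' : S.Coloring G}

theorem agreeOff_iff {σ : D.State Φ} {σ' : D.State Φ'} :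
    D.AgreeOff p σ σ' ↔ σ'.toLabeling.EqOff (plaquettePatch S p) σ.toLabeling := by
  refine ⟨fun h => ⟨fun e he => ?_, fun t ht => h.2 t (plaquettePatch_avoidsFace.mp ht)⟩,
    fun h => ⟨fun e h₁ h₂ => h.edge e ?_, fun t ht => h.vert t (plaquettePatch_avoidsFace.mpr ht)⟩⟩
  · obtain ⟨h₁, h₂⟩ := not_or.mp (plaquettePatch_avoidsEdge.mp he)
    exact h.1 e h₁ h₂
  · exact plaquettePatch_avoidsEdge.mpr (not_or.mpr ⟨h₁, h₂⟩)

end PlaquettePatch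

section BoundaryCoeff

variable {D}

theorem N_ne_zero {j₁ j₂ j₃ j₄ j₅ j₆ : D.A} {a₁ a₂ a₃ a₄ : ℕ}
    (h : D.N j₁ j₂ j₃ j₄ j₅ j₆ a₁ a₂ a₃ a₄ ≠ 0) :
    (1 ≤ a₁ ∧ a₁ ≤ D.δ j₁ j₂ (D.dual j₃)) ∧ (1 ≤ a₂ ∧ a₂ ≤ D.δ j₃ j₄ (D.dual j₅)) ∧
      (1 ≤ a₃ ∧ a₃ ≤ D.δ j₅ (D.dual j₆) (D.dual j₁)) ∧
      (1 ≤ a₄ ∧ a₄ ≤ D.δ j₆ (D.dual j₄) (D.dual j₂)) := by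
  by_contra support
  exact h (D.N_support _ _ _ _ _ _ _ _ _ _ support)

variable [Fintype V] {p : V} {s : D.A}

variable (D) in
/-- The coefficient of `B_p^s` between two labelings, provided that they are equal away from the
boundary of `p`. -/
noncomputable def boundaryCoeff (p : V) (s : D.A) (L' L : D.Labeling S) : 𝕜 :=
  D.loopCoeff (inEquiv S p) (outEquiv S p) (fun c => L.edge c.outer) s (fun w => L'.edge w.edge)
    (fun w => L.edge w.edge) (fun c => L'.vert c.face) (fun c => L.vert c.face)

theorem vert_ne_zero_of_boundaryCoeff_ne_zero {L' L : D.Labeling S}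
    (h : D.boundaryCoeff p s L' L ≠ 0) {t : S.Face} (ht : p ∈ t.1) :
    L'.vert t ≠ 0 ∧ L.vert t ≠ 0 := by
  obtain ⟨c, rfl⟩ := Face.exists_corner ht
  obtain ⟨a, -, ha⟩ := Finset.exists_ne_zero_of_sum_ne_zero h
  have support := N_ne_zero
    (right_ne_zero_of_mul (Finset.prod_ne_zero_iff.mp ha c (Finset.mem_univ c)))
  exact ⟨Nat.one_le_iff_ne_zero.mp support.2.2.1.1, Nat.one_le_iff_ne_zero.mp support.2.1.1⟩

variable {Φ Φ' : S.Coloring G} {σ' : D.State Φ'} {σ : D.State Φ}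

open Classical in
theorem stringCoeff_eq_ite : D.stringCoeff p s σ' σ =
    if σ'.toLabeling.EqOff (plaquettePatch S p) σ.toLabeling then
      D.boundaryCoeff p s σ'.toLabeling σ.toLabeling else 0 :=
  if_congr agreeOff_iff rfl rfl

end BoundaryCoeff

section Overlap

variable {D} {ι κ ι' κ' ι'' κ'' : Type*} {P : S.Patch ι κ} {P' : S.Patch ι' κ'}
  {Q : S.Patch ι'' κ''} {L L' L'' B : D.Labeling S}

/-- Equality of labelings on all edges and vertices which are in neither of the two patches. -/
structure Labeling.EqOffBoth (P : S.Patch ι κ) (P' : S.Patch ι' κ') (L' L : D.Labeling S) :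
    Prop where
  edge : ∀ e, P.AvoidsEdge e → P'.AvoidsEdge e → L'.edge e = L.edge e
  vert : ∀ t, P.AvoidsFace t → P'.AvoidsFace t → L'.vert t = L.vert t

theorem Labeling.eqOffBoth_comm : L'.EqOffBoth P P' L ↔ L'.EqOffBoth P' P L :=
  ⟨fun h => ⟨fun e h₁ h₂ => h.edge e h₂ h₁, fun t h₁ h₂ => h.vert t h₂ h₁⟩,
    fun h => ⟨fun e h₁ h₂ => h.edge e h₂ h₁, fun t h₁ h₂ => h.vert t h₂ h₁⟩⟩

theorem Labeling.eqOffBoth_self : L'.EqOffBoth P P L ↔ L'.EqOff P L :=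
  ⟨fun h => ⟨fun e he => h.edge e he he, fun t ht => h.vert t ht ht⟩,
    fun h => ⟨fun e he _ => h.edge e he, fun t ht _ => h.vert t ht⟩⟩

theorem Labeling.EqOff.trans (h' : L''.EqOff P L') (h : L'.EqOff P' L) : L''.EqOffBoth P P' L :=
  ⟨fun e h₁ h₂ => (h'.edge e h₁).trans (h.edge e h₂),
    fun t h₁ h₂ => (h'.vert t h₁).trans (h.vert t h₂)⟩

open Classical in
/-- The labeling which is `L'` on the patch and `L` elsewhere. -/
noncomputable def Labeling.patch (P : S.Patch ι κ) (L' L : D.Labeling S) : D.Labeling S where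
  edge e := if P.AvoidsEdge e then L.edge e else L'.edge e
  vert t := if P.AvoidsFace t then L.vert t else L'.vert t

theorem Labeling.patch_edge_of_avoids {e : S.OEdge} (h : P.AvoidsEdge e) :
    (Labeling.patch P L' L).edge e = L.edge e := if_pos h

theorem Labeling.patch_vert_of_avoids {t : S.Face} (h : P.AvoidsFace t) :
    (Labeling.patch P L' L).vert t = L.vert t := if_pos h

theorem Labeling.EqOffBoth.patch_edge (h : L'.EqOffBoth P P' L) {e : S.OEdge}
    (he : P.AvoidsEdge e) : (Labeling.patch P' L' L).edge e = L'.edge e := by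
  simp only [Labeling.patch, ite_eq_right_iff]
  exact fun he' => (h.edge e he he').symm

theorem Labeling.EqOffBoth.patch_vert (h : L'.EqOffBoth P P' L) {t : S.Face}
    (ht : P.AvoidsFace t) : (Labeling.patch P' L' L).vert t = L'.vert t := by
  simp only [Labeling.patch, ite_eq_right_iff]
  exact fun ht' => (h.vert t ht ht').symm

/-- The patch `Q` is the intersection of `P` and `P'`. -/
structure IsInter (Q : S.Patch ι'' κ'') (P : S.Patch ι κ) (P' : S.Patch ι' κ') : Prop where
  avoidsEdge_iff : ∀ e, Q.AvoidsEdge e ↔ P.AvoidsEdge e ∨ P'.AvoidsEdge e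
  avoidsFace_iff : ∀ t, Q.AvoidsFace t ↔ P.AvoidsFace t ∨ P'.AvoidsFace t

theorem IsInter.self : IsInter P P P := ⟨fun _ => or_self_iff.symm, fun _ => or_self_iff.symm⟩

theorem IsInter.symm (h : IsInter Q P P') : IsInter Q P' P :=
  ⟨fun e => (h.avoidsEdge_iff e).trans or_comm, fun t => (h.avoidsFace_iff t).trans or_comm⟩

theorem IsInter.eqOff_and_eqOff_iff (hQ : IsInter Q P P') (h : L''.EqOffBoth P P' L) :
    L''.EqOff P L' ∧ L'.EqOff P' L ↔ L'.EqOff Q (Labeling.patch P' L'' L) := by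
  refine ⟨fun ⟨h₁, h₂⟩ => ⟨fun e he => ?_, fun t ht => ?_⟩, fun h' => ⟨⟨fun e he => ?_,
    fun t ht => ?_⟩, ⟨fun e he => ?_, fun t ht => ?_⟩⟩⟩
  · obtain he | he := (hQ.avoidsEdge_iff e).mp he
    · rw [h.patch_edge he, h₁.edge e he]
    · rw [Labeling.patch_edge_of_avoids he, h₂.edge e he]
  · obtain ht | ht := (hQ.avoidsFace_iff t).mp ht
    · rw [h.patch_vert ht, h₁.vert t ht]
    · rw [Labeling.patch_vert_of_avoids ht, h₂.vert t ht]
  · rw [h'.edge e ((hQ.avoidsEdge_iff e).mpr (.inl he)), h.patch_edge he]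
  · rw [h'.vert t ((hQ.avoidsFace_iff t).mpr (.inl ht)), h.patch_vert ht]
  · rw [h'.edge e ((hQ.avoidsEdge_iff e).mpr (.inr he)), Labeling.patch_edge_of_avoids he]
  · rw [h'.vert t ((hQ.avoidsFace_iff t).mpr (.inr ht)), Labeling.patch_vert_of_avoids ht]

variable {Φ Φ' Φ'' : S.Coloring G}

theorem IsInter.isStateOff_patch (hQ : IsInter Q P P') {σ'' : D.State Φ''} {σ : D.State Φ}
    (h : σ''.toLabeling.EqOffBoth P P' σ.toLabeling)
    (hΦ'' : ∀ e, P.AvoidsEdge e → Φ''.val e = Φ'.val e)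
    (hΦ' : ∀ e, P'.AvoidsEdge e → Φ'.val e = Φ.val e) :
    (Labeling.patch P' σ''.toLabeling σ.toLabeling).IsStateOff Q Φ' := by
  refine ⟨fun e he => ?_, fun e he => ?_, fun f hf => ?_⟩
  · obtain he | he := (hQ.avoidsEdge_iff e).mp he
    · rw [h.patch_edge he, ← hΦ'' e he]
      exact σ''.deg_edge e
    · rw [Labeling.patch_edge_of_avoids he, hΦ' e he]
      exact σ.deg_edge e
  · obtain he | he := (hQ.avoidsEdge_iff e).mp he
    · rw [h.patch_edge he, h.patch_edge he.symm]
      exact σ''.edge_symm e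
    · rw [Labeling.patch_edge_of_avoids he, Labeling.patch_edge_of_avoids he.symm]
      exact σ.edge_symm e
  · obtain hf | hf := (hQ.avoidsFace_iff f.face).mp hf
    · rw [h.patch_vert hf, mult_eq_of_avoidsFace (fun _ => h.patch_edge) hf]
      exact σ''.vert_le f
    · rw [Labeling.patch_vert_of_avoids hf,
        mult_eq_of_avoidsFace (fun _ => Labeling.patch_edge_of_avoids) hf]
      exact σ.vert_le f

end Overlap

section Composition

variable [Fintype V] {D} {p q : V} {s t : D.A} {Φ₀ Φ₁ Φ₂ : S.Coloring G} {σ₂ : D.State Φ₂}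
  {σ₀ : D.State Φ₀}

theorem sum_stringCoeff_mul_eq_zero
    (h : ¬ σ₂.toLabeling.EqOffBoth (plaquettePatch S p) (plaquettePatch S q) σ₀.toLabeling) :
    ∑ σ₁ : D.State Φ₁, D.stringCoeff p s σ₂ σ₁ * D.stringCoeff q t σ₁ σ₀ = 0 := by
  classical
  refine Finset.sum_eq_zero fun σ₁ _ => ?_
  rw [stringCoeff_eq_ite, stringCoeff_eq_ite, ite_zero_mul_ite_zero]
  exact if_neg fun h' => h (h'.1.trans h'.2)

open Finset in
theorem sum_stringCoeff_mul_eq_sum_relabel {ι κ : Type*} [Fintype ι] [DecidableEq ι] [Fintype κ]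
    [DecidableEq κ] {Q : S.Patch ι κ} (hQ : IsInter Q (plaquettePatch S p) (plaquettePatch S q))
    {g h : G} (hΦ₁ : Φ₁ = Φ₀ + S.plaquetteColoring h q) (hΦ₂ : Φ₂ = Φ₁ + S.plaquetteColoring g p)
    (hσ : σ₂.toLabeling.EqOffBoth (plaquettePatch S p) (plaquettePatch S q) σ₀.toLabeling)
    {B : D.Labeling S}
    (hB : B = Labeling.patch (plaquettePatch S q) σ₂.toLabeling σ₀.toLabeling) :
    ∑ σ₁ : D.State Φ₁, D.stringCoeff p s σ₂ σ₁ * D.stringCoeff q t σ₁ σ₀ =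
      ∑ j ∈ Fintype.piFinset fun i => D.I (Φ₁.val (Q.edge i)),
        ∑ C ∈ Fintype.piFinset fun k => Icc 1 (D.mult (relabelEdge Q B.edge j) (Q.flag k)),
          D.boundaryCoeff p s σ₂.toLabeling (B.relabel Q j C) *
            D.boundaryCoeff q t (B.relabel Q j C) σ₀.toLabeling := by
  classical
  subst hB
  let F (L : D.Labeling S) : 𝕜 :=
    if σ₂.toLabeling.EqOff (plaquettePatch S p) L ∧ L.EqOff (plaquettePatch S q) σ₀.toLabeling
    then D.boundaryCoeff p s σ₂.toLabeling L * D.boundaryCoeff q t L σ₀.toLabeling else 0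
  have mul_eq (σ₁ : D.State Φ₁) :
      D.stringCoeff p s σ₂ σ₁ * D.stringCoeff q t σ₁ σ₀ = F σ₁.toLabeling := by
    simp only [stringCoeff_eq_ite, ite_zero_mul_ite_zero, F]
  have isStateOff := hQ.isStateOff_patch hσ
    (fun e he => val_eq_of_not_onBoundary (plaquettePatch_avoidsEdge.mp he) hΦ₂)
    (fun e he => val_eq_of_not_onBoundary (plaquettePatch_avoidsEdge.mp he) hΦ₁)
  rw [sum_congr rfl fun σ₁ _ => mul_eq σ₁, sum_state_eq_sum_relabel isStateOff F]
  · exact sum_congr rfl fun j _ => sum_congr rfl fun C _ =>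
      if_pos ((hQ.eqOff_and_eqOff_iff hσ).mpr (Labeling.relabel_eqOff _ _ _ _))
  · intro σ₁ hF
    obtain ⟨hσ₁, hne⟩ := ite_ne_right_iff.mp hF
    refine ⟨(hQ.eqOff_and_eqOff_iff hσ).mp hσ₁, fun k => ?_⟩
    have face_mem : p ∈ (Q.flag k).face.1 := by
      by_contra h
      exact (hQ.avoidsFace_iff _).mpr (.inl (plaquettePatch_avoidsFace.mpr h)) k rfl
    exact (vert_ne_zero_of_boundaryCoeff_ne_zero (left_ne_zero_of_mul hne) face_mem).2

section Relabel

variable (L B : D.Labeling S) (j : S.Side p → D.A) (C : S.Corner p → ℕ)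

theorem boundaryCoeff_relabel_right : D.boundaryCoeff p s L (B.relabel (plaquettePatch S p) j C) =
    D.loopCoeff (inEquiv S p) (outEquiv S p) (fun c => B.edge c.outer) s (fun w => L.edge w.edge) j
      (fun c => L.vert c.face) C := by
  have outer_eq (c : S.Corner p) :
      (B.relabel (plaquettePatch S p) j C).edge c.outer = B.edge c.outer :=
    relabelEdge_of_avoids _ _ (plaquettePatch_avoidsEdge.mpr c.not_onBoundary_outer)
  have edge_eq (w : S.Side p) : (B.relabel (plaquettePatch S p) j C).edge w.edge = j w :=
    relabelEdge_apply (plaquettePatch S p) _ _ w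
  have vert_eq (c : S.Corner p) : (B.relabel (plaquettePatch S p) j C).vert c.face = C c :=
    B.relabel_vert_apply (plaquettePatch S p) _ _ c
  simp only [boundaryCoeff, outer_eq, edge_eq, vert_eq]

theorem boundaryCoeff_relabel_left : D.boundaryCoeff p s (B.relabel (plaquettePatch S p) j C) L =
    D.loopCoeff (inEquiv S p) (outEquiv S p) (fun c => L.edge c.outer) s j (fun w => L.edge w.edge)
      C (fun c => L.vert c.face) := by
  have edge_eq (w : S.Side p) : (B.relabel (plaquettePatch S p) j C).edge w.edge = j w :=
    relabelEdge_apply (plaquettePatch S p) _ _ w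
  have vert_eq (c : S.Corner p) : (B.relabel (plaquettePatch S p) j C).vert c.face = C c :=
    B.relabel_vert_apply (plaquettePatch S p) _ _ c
  simp only [boundaryCoeff, edge_eq, vert_eq]

variable {B} in
omit [Fintype V] in
theorem mult_relabelEdge_corner {c : S.Corner p}
    (h : B.edge c.outer.symm = D.dual (B.edge c.outer)) :
    D.mult (relabelEdge (plaquettePatch S p) B.edge j) c.flag =
      D.δ (j c.sideIn) (D.dual (j c.sideOut)) (D.dual (B.edge c.outer)) := by
  have out_eq : relabelEdge (plaquettePatch S p) B.edge j c.flag.e₁ = D.dual (j c.sideOut) :=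
    relabelEdge_symm (plaquettePatch S p) _ _ c.sideOut
  have outer_eq : relabelEdge (plaquettePatch S p) B.edge j c.flag.e₂ = D.dual (B.edge c.outer) :=
    (relabelEdge_of_avoids _ _ (plaquettePatch_avoidsEdge.mpr
      (mt onBoundary_symm.mp c.not_onBoundary_outer))).trans h
  have in_eq : relabelEdge (plaquettePatch S p) B.edge j c.flag.e₃ = j c.sideIn :=
    relabelEdge_apply (plaquettePatch S p) _ _ c.sideIn
  rw [mult, out_eq, outer_eq, in_eq, ← D.δ_rotate]

end Relabel

open Finset in
theorem sum_stringCoeff_mul_self (hΦ₁ : Φ₁ = Φ₀ + S.plaquetteColoring (D.deg t) p)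
    (hΦ₂ : Φ₂ = Φ₁ + S.plaquetteColoring (D.deg s) p) (admissible : D.Admissible Φ₁)
    (hX : D.deg s + D.deg t ∉ D.X) :
    ∑ σ₁ : D.State Φ₁, D.stringCoeff p s σ₂ σ₁ * D.stringCoeff p t σ₁ σ₀ =
      ∑ r ∈ D.I (D.deg s + D.deg t), (D.δ s t (D.dual r) : 𝕜) * D.stringCoeff p r σ₂ σ₀ := by
  classical
  by_cases hσ : σ₂.toLabeling.EqOff (plaquettePatch S p) σ₀.toLabeling
  swap
  · rw [sum_stringCoeff_mul_eq_zero (mt Labeling.eqOffBoth_self.mp hσ)]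
    simp only [stringCoeff_eq_ite, if_neg hσ, mul_zero, sum_const_zero]
  set B := Labeling.patch (plaquettePatch S p) σ₂.toLabeling σ₀.toLabeling with hB
  have outer_eq (c : S.Corner p) : B.edge c.outer = σ₀.edge c.outer :=
    Labeling.patch_edge_of_avoids (plaquettePatch_avoidsEdge.mpr c.not_onBoundary_outer)
  have outer_symm (c : S.Corner p) : B.edge c.outer.symm = D.dual (B.edge c.outer) := by
    rw [outer_eq, ← σ₀.edge_symm]
    exact Labeling.patch_edge_of_avoids (plaquettePatch_avoidsEdge.mpr
      (mt onBoundary_symm.mp c.not_onBoundary_outer))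
  have val_eq (w : S.Side p) : Φ₁.val w.edge = D.deg (σ₀.edge w.edge) - D.deg t := by
    rw [w.val_edge_of_eq_add hΦ₁, σ₀.deg_edge]
  have := Side.nonempty S p
  have fusion := sum_loopCoeff_mul_loopCoeff (inEquiv S p) (outEquiv S p)
    (fun f hf => Side.eq_of_forall_corner hf) hX (fun c => σ₀.edge c.outer)
    (j₂ := fun w => σ₂.edge w.edge) (fun w => val_eq w ▸ admissible _)
    (fun c => σ₂.vert c.face) (fun c => σ₀.vert c.face)
  rw [sum_stringCoeff_mul_eq_sum_relabel IsInter.self hΦ₁ hΦ₂ (Labeling.eqOffBoth_self.mpr hσ) hB]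
  simp only [stringCoeff_eq_ite, if_pos hσ]
  refine Eq.trans ?_ fusion
  simp only [← val_eq]
  refine sum_congr rfl fun j _ => sum_congr ?_ fun C _ => ?_
  · refine congrArg Fintype.piFinset (funext fun c => congrArg (Icc 1) ?_)
    exact (mult_relabelEdge_corner j (outer_symm c)).trans (outer_eq c ▸ rfl)
  · rw [boundaryCoeff_relabel_right, boundaryCoeff_relabel_left]
    simp only [outer_eq]
    rfl

end Composition

section Fusion

open Finset

theorem sum_smul_comp_sum_smul {R M₁ M₂ M₃ ι κ : Type*} [CommSemiring R] [AddCommMonoid M₁]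
    [AddCommMonoid M₂] [AddCommMonoid M₃] [Module R M₁] [Module R M₂] [Module R M₃]
    (s : Finset ι) (t : Finset κ) (a : ι → R) (b : κ → R) (f : ι → M₂ →ₗ[R] M₃)
    (h : κ → M₁ →ₗ[R] M₂) :
    (∑ i ∈ s, a i • f i) ∘ₗ (∑ k ∈ t, b k • h k) =
      ∑ i ∈ s, ∑ k ∈ t, (a i * b k) • (f i ∘ₗ h k) := by
  ext x
  simp only [LinearMap.comp_apply, LinearMap.sum_apply, LinearMap.smul_apply, map_sum, map_smul,
    smul_sum, smul_smul]
  rw [sum_comm]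
  simp only [mul_comm]

variable [Fintype V] {D} {p : V} {Φ₀ Φ₁ Φ₂ : S.Coloring G}

theorem stringOp_comp_self {s t : D.A} (hΦ₁ : Φ₁ = Φ₀ + S.plaquetteColoring (D.deg t) p)
    (hΦ₂ : Φ₂ = Φ₁ + S.plaquetteColoring (D.deg s) p) (admissible : D.Admissible Φ₁)
    (hX : D.deg s + D.deg t ∉ D.X) :
    D.stringOp p s Φ₁ Φ₂ ∘ₗ D.stringOp p t Φ₀ Φ₁ =
      ∑ r ∈ D.I (D.deg s + D.deg t), (D.δ s t (D.dual r) : 𝕜) • D.stringOp p r Φ₀ Φ₂ := by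
  have mul_eq : (Matrix.of fun (σ₂ : D.State Φ₂) (σ₁ : D.State Φ₁) => D.stringCoeff p s σ₂ σ₁) *
      (Matrix.of fun (σ₁ : D.State Φ₁) (σ₀ : D.State Φ₀) => D.stringCoeff p t σ₁ σ₀) =
      ∑ r ∈ D.I (D.deg s + D.deg t), (D.δ s t (D.dual r) : 𝕜) •
        Matrix.of fun (σ₂ : D.State Φ₂) (σ₀ : D.State Φ₀) => D.stringCoeff p r σ₂ σ₀ := by
    ext σ₂ σ₀
    rw [Matrix.mul_apply, Matrix.sum_apply]
    exact sum_stringCoeff_mul_self hΦ₁ hΦ₂ admissible hX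
  rw [stringOp, stringOp, ← Matrix.mulVecLin_mul, mul_eq]
  ext ψ : 1
  simp only [stringOp, LinearMap.sum_apply, Matrix.mulVecLin_apply, LinearMap.smul_apply,
    Matrix.sum_mulVec, Matrix.smul_mulVec]

theorem gradedPlaquetteOp_comp_self {g₁ g₂ : G} (hΦ₁ : Φ₁ = Φ₀ + S.plaquetteColoring g₂ p)
    (hΦ₂ : Φ₂ = Φ₁ + S.plaquetteColoring g₁ p) (admissible : D.Admissible Φ₁) (h₁ : g₁ ∉ D.X)
    (h₂ : g₂ ∉ D.X) (hX : g₁ + g₂ ∉ D.X) :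
    D.gradedPlaquetteOp p g₁ Φ₁ Φ₂ ∘ₗ D.gradedPlaquetteOp p g₂ Φ₀ Φ₁ =
      D.gradedPlaquetteOp p (g₁ + g₂) Φ₀ Φ₂ := by
  have b_smul_eq : ∀ r ∈ D.I (g₁ + g₂), D.b r • D.stringOp p r Φ₀ Φ₂ =
      ∑ s ∈ D.I g₁, ∑ t ∈ D.I g₂,
        (D.b s * D.b t) • (D.δ s t (D.dual r) : 𝕜) • D.stringOp p r Φ₀ Φ₂ := by
    intro r hr
    simp only [D.b_fusion g₁ g₂ h₁ h₂ r (D.mem_I.mp hr), sum_smul, smul_smul, D.δ_rotate]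
  simp only [gradedPlaquetteOp]
  rw [sum_congr rfl b_smul_eq, sum_comm, sum_smul_comp_sum_smul]
  refine sum_congr rfl fun s hs => ?_
  rw [sum_comm]
  refine sum_congr rfl fun t ht => ?_
  obtain rfl := D.mem_I.mp hs
  obtain rfl := D.mem_I.mp ht
  rw [stringOp_comp_self hΦ₁ hΦ₂ admissible hX, smul_sum]

variable {Φ : S.Coloring G} {g h : G}

omit [Fintype V] in
theorem GenericAt.neg_notMem (hg : D.GenericAt Φ p g) : -g ∉ D.X :=
  mt D.neg_mem_X_iff.mp hg.1

theorem plaquetteOp_eq_of_sub_notMem (hg : D.GenericAt Φ p g) (hh : D.GenericAt Φ p h)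
    (hX : g - h ∉ D.X) : D.plaquetteOp Φ p g = D.plaquetteOp Φ p h := by
  have lower : D.gradedPlaquetteOp p (g - h) (Φ + S.plaquetteColoring (-g) p)
        (Φ + S.plaquetteColoring (-h) p) ∘ₗ
      D.gradedPlaquetteOp p (-g) Φ (Φ + S.plaquetteColoring (-g) p) =
      D.gradedPlaquetteOp p (-h) Φ (Φ + S.plaquetteColoring (-h) p) := by
    have deg_eq : g - h + -g = -h := by abel
    rw [gradedPlaquetteOp_comp_self rfl (by rw [add_plaquetteColoring_add, add_comm, deg_eq])
      hg.2 hX hg.neg_notMem (deg_eq ▸ hh.neg_notMem), deg_eq]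
  have upper : D.gradedPlaquetteOp p h (Φ + S.plaquetteColoring (-h) p) Φ ∘ₗ
      D.gradedPlaquetteOp p (g - h) (Φ + S.plaquetteColoring (-g) p)
        (Φ + S.plaquetteColoring (-h) p) =
      D.gradedPlaquetteOp p g (Φ + S.plaquetteColoring (-g) p) Φ := by
    have deg_eq : h + (g - h) = g := by abel
    have coloring_eq : Φ + S.plaquetteColoring (-h) p =
        Φ + S.plaquetteColoring (-g) p + S.plaquetteColoring (g - h) p := by
      rw [add_plaquetteColoring_add, neg_add_eq_sub, sub_sub_cancel_left]
    rw [gradedPlaquetteOp_comp_self coloring_eq add_plaquetteColoring_neg_add.symm hh.2 hh.1 hX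
      (deg_eq.symm ▸ hg.1), deg_eq]
  rw [plaquetteOp, plaquetteOp, ← lower, ← upper, LinearMap.comp_assoc]

theorem plaquetteOp_eq (admissible : D.Admissible Φ) (hg : D.GenericAt Φ p g)
    (hh : D.GenericAt Φ p h) : D.plaquetteOp Φ p g = D.plaquetteOp Φ p h := by
  obtain ⟨k, hk, -, sub_notMem⟩ := D.exists_genericAt admissible admissible p (Set.toFinite {g, h})
  rw [← plaquetteOp_eq_of_sub_notMem hk hg (sub_notMem g (by simp)),
    plaquetteOp_eq_of_sub_notMem hk hh (sub_notMem h (by simp))]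

theorem plaquetteOp_mul_of_sub_notMem (admissible : D.Admissible Φ) (hg : D.GenericAt Φ p g)
    (hh : D.GenericAt Φ p h) (hX : h - g ∉ D.X) :
    D.plaquetteOp Φ p g * D.plaquetteOp Φ p h = D.plaquetteOp Φ p g := by
  have deg_eq₁ : -g + h = h - g := by abel
  have deg_eq₂ : h - g + -h = -g := by abel
  have absorb : D.gradedPlaquetteOp p (-g) Φ (Φ + S.plaquetteColoring (-g) p) ∘ₗ
      D.plaquetteOp Φ p h = D.gradedPlaquetteOp p (-g) Φ (Φ + S.plaquetteColoring (-g) p) := by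
    rw [plaquetteOp, ← LinearMap.comp_assoc, gradedPlaquetteOp_comp_self
      add_plaquetteColoring_neg_add.symm rfl admissible hg.neg_notMem hh.1 (deg_eq₁ ▸ hX), deg_eq₁,
      gradedPlaquetteOp_comp_self rfl (by rw [add_plaquetteColoring_add, add_comm, deg_eq₂]) hh.2
        hX hh.neg_notMem (deg_eq₂ ▸ hg.neg_notMem), deg_eq₂]
  rw [Module.End.mul_eq_comp, plaquetteOp, LinearMap.comp_assoc, absorb]

theorem plaquetteOp_mul_self (admissible : D.Admissible Φ) (hg : D.GenericAt Φ p g) :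
    D.plaquetteOp Φ p g * D.plaquetteOp Φ p g = D.plaquetteOp Φ p g := by
  obtain ⟨h, hh, -, sub_notMem⟩ := D.exists_genericAt admissible admissible p (Set.toFinite {g})
  calc D.plaquetteOp Φ p g * D.plaquetteOp Φ p g
      = D.plaquetteOp Φ p g * D.plaquetteOp Φ p h := by rw [plaquetteOp_eq admissible hg hh]
    _ = D.plaquetteOp Φ p g := plaquetteOp_mul_of_sub_notMem admissible hg hh (sub_notMem g rfl)

end Fusion

section EdgeCoeff

open Finset

theorem sum_sum_comm_sum_sum {α β γ δ M : Type*} [AddCommMonoid M] (s : Finset α) (t : Finset β)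
    (u : Finset γ) (v : Finset δ) (f : α → β → γ → δ → M) :
    ∑ a ∈ s, ∑ b ∈ t, ∑ c ∈ u, ∑ d ∈ v, f a b c d =
      ∑ c ∈ u, ∑ d ∈ v, ∑ a ∈ s, ∑ b ∈ t, f a b c d := by
  simp only [← sum_product' s t, ← sum_product' u v]
  exact sum_comm

theorem sum_mul_sum_mul_comm {α β R : Type*} [CommSemiring R] (s : Finset α) (t : Finset β)
    {k k' : R} (hk : k = k') (d g : α → R) (e h : β → R) (T : α → β → R) :
    ∑ a ∈ s, k * d a * ((∑ b ∈ t, e b * T a b * h b) * g a) =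
      ∑ b ∈ t, k' * e b * ((∑ a ∈ s, d a * T a b * g a) * h b) := by
  subst hk
  simp only [mul_sum, sum_mul]
  rw [sum_comm]
  exact sum_congr rfl fun b _ => sum_congr rfl fun a _ => by ring

variable {D}

theorem N_symm₃ (j₁ j₂ j₃ j₄ j₅ j₆ : D.A) (a₁ a₂ a₃ a₄ : ℕ) :
    D.N j₁ j₂ j₃ j₄ j₅ j₆ a₁ a₂ a₃ a₄ =
      D.N (D.dual j₂) j₆ j₄ (D.dual j₅) (D.dual j₃) (D.dual j₁) a₄ a₂ a₁ a₃ := by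
  rw [D.N_symm₁ j₁, D.N_symm₁ j₂, D.N_symm₂ (D.dual j₃)]
  simp only [D.dual_dual]

theorem N_symm₄ (j₁ j₂ j₃ j₄ j₅ j₆ : D.A) (a₁ a₂ a₃ a₄ : ℕ) :
    D.N j₁ j₂ j₃ j₄ j₅ j₆ a₁ a₂ a₃ a₄ =
      D.N (D.dual j₄) (D.dual j₂) (D.dual j₆) (D.dual j₁) (D.dual j₅) (D.dual j₃) a₄ a₃ a₂ a₁ := by
  rw [D.N_symm₁ j₁, D.N_symm₂ j₂, D.N_symm₂ (D.dual j₁), D.N_symm₁ j₆]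
  simp only [D.dual_dual]

/-- At the vertex where the first string enters a common side labelled `x` and the second one
leaves it, the pentagon identity moves the first string across the second one. -/
theorem sum_N_mul_N_eq_sum_of_first (s t x x₀ x₂ α₀ α₂ β₀ β₂ : D.A) (a b c₀ c₂ A B : ℕ)
    (hX : D.deg (D.dual x₂) + D.deg t ∉ D.X) :
    ∑ c ∈ Icc 1 (D.δ (D.dual x) (D.dual β₂) α₀),
      D.N (D.dual x) t (D.dual x₀) (D.dual β₀) (D.dual α₀) (D.dual β₂) B c₀ c b *
        D.N α₂ s α₀ (D.dual x) β₂ (D.dual x₂) a c c₂ A =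
    ∑ n ∈ D.I (D.deg (D.dual x₂) + D.deg t), ∑ K ∈ Icc 1 (D.δ (D.dual n) s (D.dual x₀)),
      ∑ L ∈ Icc 1 (D.δ (D.dual x₂) t (D.dual n)),
        D.d n * D.N (D.dual s) (D.dual x₂) (D.dual x) t (D.dual x₀) n A B K L *
          ∑ c ∈ Icc 1 (D.δ n (D.dual β₀) α₂),
            D.N α₂ s α₀ (D.dual x₀) β₀ n a c₀ c K *
              D.N (D.dual x₂) t n (D.dual β₀) (D.dual α₂) (D.dual β₂) L c c₂ b := by
  have pentagon := D.pentagon (D.dual α₀) (D.dual s) (D.dual x₂) t (D.dual β₀) (D.dual x)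
    (D.dual x₀) (D.dual α₂) (D.dual β₂) a A B c₀ c₂ b hX
  have δ_reflect (n : D.A) : D.δ (D.dual s) n x₀ = D.δ (D.dual n) s (D.dual x₀) := by
    rw [D.δ_dual (D.dual n), D.dual_dual, D.dual_dual, ← D.δ_rotate]
  simp only [D.dual_dual, δ_reflect] at pentagon
  simp only [N_symm₃ α₂ s]
  rw [← pentagon]
  refine sum_congr rfl fun n _ => sum_congr rfl fun K _ => sum_congr rfl fun L _ => ?_
  rw [mul_sum]
  exact sum_congr rfl fun c _ => by ring

theorem sum_N_mul_N_eq_sum_of_second (s t n x₀ x₂ ζ₀ ζ₂ η₀ η₂ : D.A) (a' b' c₀' c₂' K L : ℕ)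
    (hX : D.deg x₂ + D.deg s ∉ D.X) :
    ∑ c' ∈ Icc 1 (D.δ (D.dual n) (D.dual ζ₂) η₀),
      D.N (D.dual n) s x₀ (D.dual ζ₀) (D.dual η₀) (D.dual ζ₂) K c₀' c' a' *
        D.N η₂ t η₀ (D.dual n) ζ₂ x₂ b' c' c₂' L =
    ∑ x ∈ D.I (D.deg x₂ + D.deg s), ∑ B ∈ Icc 1 (D.δ (D.dual x) t x₀),
      ∑ A ∈ Icc 1 (D.δ x₂ s (D.dual x)),
        D.d x * D.N (D.dual s) (D.dual x₂) (D.dual x) t (D.dual x₀) n A B K L *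
          ∑ c' ∈ Icc 1 (D.δ x (D.dual ζ₀) η₂),
            D.N η₂ t η₀ x₀ ζ₀ x b' c₀' c' B *
              D.N x₂ s x (D.dual ζ₀) (D.dual η₂) (D.dual ζ₂) A c' c₂' a' := by
  have crossing := sum_N_mul_N_eq_sum_of_first t s n (D.dual x₀) (D.dual x₂) η₀ η₂ ζ₀ ζ₂
    b' a' c₀' c₂' L K (by rwa [D.dual_dual])
  simp only [D.dual_dual] at crossing
  rw [crossing]
  simp only [N_symm₄ (D.dual t), D.dual_dual]

variable (D) in
/-- The labels around a side common to two plaquettes: the side itself, as a side of the first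
plaquette, its neighbours `in₁, out₁` and `in₂, out₂` among the sides of the two plaquettes, and
its end points, of which `vert` is the one on `in₁` and `out₂`. -/
structure EdgeLabels where
  side : D.A
  in₁ : D.A
  out₁ : D.A
  in₂ : D.A
  out₂ : D.A
  vert : ℕ
  vert' : ℕ

/-- The labels seen from the second plaquette. -/
def EdgeLabels.swap (L : D.EdgeLabels) : D.EdgeLabels :=
  ⟨D.dual L.side, L.in₂, L.out₂, L.in₁, L.out₁, L.vert', L.vert⟩

/-- The contribution to `loopCoeff` of the two corners of the first plaquette at the common
side. -/
def sideCoeff (s : D.A) (L' L : D.EdgeLabels) (a a' : ℕ) : 𝕜 :=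
  ∑ A ∈ Icc 1 (D.δ L'.side s (D.dual L.side)),
    D.cornerCoeff L.out₂ s L'.in₁ L'.side L.in₁ L.side L'.vert L.vert a A *
      D.cornerCoeff (D.dual L.in₂) s L'.side L'.out₁ L.side L.out₁ L'.vert' L.vert' A a'

/-- The labels after the second string, which changes `in₂` and `out₂`, has been added. -/
def EdgeLabels.middle (L₂ L₀ : D.EdgeLabels) (x : D.A) (c c' : ℕ) : D.EdgeLabels :=
  ⟨x, L₀.in₁, L₀.out₁, L₂.in₂, L₂.out₂, c, c'⟩

/-- The contribution of the common side and its end points to the product of two plaquette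
operators. -/
noncomputable def edgeCoeff (s t : D.A) (L₂ L₀ : D.EdgeLabels) (a a' b b' : ℕ) : 𝕜 :=
  ∑ x ∈ D.I (D.deg L₂.side + D.deg s), ∑ c ∈ Icc 1 (D.δ (D.dual x) (D.dual L₂.out₂) L₀.in₁),
    ∑ c' ∈ Icc 1 (D.δ x (D.dual L₀.out₁) L₂.in₂),
      sideCoeff s L₂ (L₂.middle L₀ x c c') a a' *
        sideCoeff t (L₂.middle L₀ x c c').swap L₀.swap b b'

theorem edgeCoeff_eq_sum_mul (s t : D.A) (L₂ L₀ : D.EdgeLabels) (a a' b b' : ℕ) :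
    edgeCoeff s t L₂ L₀ a a' b b' =
    ∑ x ∈ D.I (D.deg L₂.side + D.deg s), ∑ B ∈ Icc 1 (D.δ (D.dual x) t L₀.side),
      ∑ A ∈ Icc 1 (D.δ L₂.side s (D.dual x)),
        D.d L₂.in₁ * D.d L₂.side * D.d L₂.in₂ * D.d x *
        ((∑ c ∈ Icc 1 (D.δ (D.dual x) (D.dual L₂.out₂) L₀.in₁),
          D.N (D.dual x) t (D.dual L₀.side) (D.dual L₀.out₂) (D.dual L₀.in₁) (D.dual L₂.out₂)
              B L₀.vert c b' *
            D.N L₂.in₁ s L₀.in₁ (D.dual x) L₂.out₂ (D.dual L₂.side) a c L₂.vert A) *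
        ∑ c' ∈ Icc 1 (D.δ x (D.dual L₀.out₁) L₂.in₂),
          D.N L₂.in₂ t L₀.in₂ L₀.side L₀.out₁ x b L₀.vert' c' B *
            D.N L₂.side s x (D.dual L₀.out₁) (D.dual L₂.in₂) (D.dual L₂.out₁)
              A c' L₂.vert' a') := by
  refine sum_congr rfl fun x _ => ?_
  simp only [sideCoeff, EdgeLabels.middle, EdgeLabels.swap, cornerCoeff, D.dual_dual, D.d_dual,
    sum_mul_sum]
  rw [sum_sum_comm_sum_sum, sum_comm]
  simp only [mul_sum]
  exact sum_congr rfl fun B _ => sum_congr rfl fun A _ => sum_congr rfl fun c _ =>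
    sum_congr rfl fun c' _ => by ring

theorem edgeCoeff_swap {s t : D.A} {L₂ L₀ : D.EdgeLabels} (hs : D.deg L₂.side + D.deg s ∉ D.X)
    (ht : D.deg (D.dual L₂.side) + D.deg t ∉ D.X) (a a' b b' : ℕ) :
    edgeCoeff s t L₂ L₀ a a' b b' = edgeCoeff t s L₂.swap L₀.swap b b' a a' := by
  rw [edgeCoeff_eq_sum_mul, edgeCoeff_eq_sum_mul]
  simp only [EdgeLabels.swap, D.dual_dual, D.d_dual]
  simp only [sum_N_mul_N_eq_sum_of_first s t _ _ _ _ _ _ _ _ _ _ _ _ _ ht,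
    sum_N_mul_N_eq_sum_of_second s t _ _ _ _ _ _ _ _ _ _ _ _ _ hs, sum_sigma']
  exact sum_mul_sum_mul_comm _ _ (by ring) _ _ _ _ _

end EdgeCoeff

section Diamond

variable (S) in
/-- The triangles `p, q, u` and `q, p, v` on the two sides of an edge `p, q` of the triangulation,
so that the plaquettes `p` and `q` have the side between `u` and `v` in common. -/
structure Diamond (p q u v : V) : Prop where
  left : S.tri p q u
  right : S.tri q p v

namespace Diamond

variable {p q u v : V} (h : Diamond S p q u v)

include h

section

omit [DecidableEq V]

theorem swap : Diamond S q p v u := ⟨h.right, h.left⟩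

theorem adj_base : S.graph.Adj q p := ⟨v, h.right⟩

theorem adj_left_fst : S.graph.Adj u p := ⟨q, S.tri_rotate (S.tri_rotate h.left)⟩

theorem adj_left_snd : S.graph.Adj u q := S.tri_opposite (S.tri_rotate h.left)

omit h in
theorem exists_of_adj (hpq : S.graph.Adj p q) : ∃ u v, Diamond S p q u v := by
  obtain ⟨u, hu⟩ := hpq
  obtain ⟨v, hv⟩ := S.tri_opposite hu
  exact ⟨u, v, hu, hv⟩

end

/-- The common side, as an edge on the boundary of `p`. -/
def side : S.Side p := ⟨q, h.adj_base⟩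

/-- The side of `p` before the common side. -/
def sideLeft : S.Side p := ⟨u, h.adj_left_fst⟩

/-- The side of `p` after the common side. -/
def sideRight : S.Side p := ⟨v, h.swap.adj_left_snd⟩

/-- The corner of `p` before the common side. -/
def cornerLeft : S.Corner p := ⟨(q, u), h.left⟩

/-- The corner of `p` after the common side. -/
def cornerRight : S.Corner p := ⟨(v, q), S.tri_rotate h.right⟩

theorem face_cornerLeft : h.cornerLeft.face = h.swap.cornerRight.face :=
  (Flag.face_rotate ⟨(p, q, u), h.left⟩).symm

theorem face_cornerRight : h.cornerRight.face = h.swap.cornerLeft.face :=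
  h.swap.face_cornerLeft.symm

omit [DecidableEq V] in
theorem cornerLeft_ne_cornerRight : h.cornerLeft ≠ h.cornerRight := fun e =>
  h.swap.adj_left_fst.ne (congrArg (·.1.1) e).symm

theorem mem_face_iff (c : S.Corner p) :
    q ∈ c.face.1 ↔ c = h.cornerLeft ∨ c = h.cornerRight := by
  constructor
  · obtain ⟨⟨x, y⟩, hc⟩ := c
    simp only [Corner.face, Flag.face, Finset.mem_insert, Finset.mem_singleton]
    rintro (rfl | rfl | rfl)
    · exact absurd rfl h.adj_base.ne
    · have hc' : S.tri p q y := hc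
      obtain rfl := S.tri_unique hc' h.left
      exact .inl rfl
    · have hc' : S.tri q p x := S.tri_rotate (S.tri_rotate hc)
      obtain rfl := S.tri_unique hc' h.right
      exact .inr rfl
  · rintro (rfl | rfl)
    · rw [h.face_cornerLeft]
      exact Corner.mem_face _
    · rw [h.face_cornerRight]
      exact Corner.mem_face _

/-- The patch of the common side and its end points. -/
def patch : S.Patch Unit Bool where
  edge _ := h.side.edge
  flag k := cond k h.cornerRight.flag h.cornerLeft.flag
  edge_injective _ _ _ := rfl
  edge_ne_symm _ _ := h.side.edge_ne_symm h.side
  face_injective := by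
    have face_ne : h.cornerLeft.flag.face ≠ h.cornerRight.flag.face := fun e =>
      h.cornerLeft_ne_cornerRight (Corner.face_injective e)
    rintro (_ | _) (_ | _) e
    exacts [rfl, absurd e face_ne, absurd e.symm face_ne, rfl]
  exists_face_eq := by
    rintro - ⟨⟨a, b, c⟩, hf⟩ (e | e)
    · obtain rfl : q = a := congrArg (fun e : S.OEdge => e.fst) e
      obtain rfl : p = b := congrArg (fun e : S.OEdge => e.snd) e
      obtain rfl := S.tri_unique hf h.right
      exact ⟨true, h.face_cornerRight⟩
    · obtain rfl : p = a := congrArg (fun e : S.OEdge => e.fst) e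
      obtain rfl : q = b := congrArg (fun e : S.OEdge => e.snd) e
      obtain rfl := S.tri_unique hf h.left
      exact ⟨false, rfl⟩

theorem isInter_patch : IsInter h.patch (plaquettePatch S p) (plaquettePatch S q) := by
  refine ⟨fun e => ?_, fun t => ?_⟩
  · rw [plaquettePatch_avoidsEdge, plaquettePatch_avoidsEdge, ← not_and_or]
    refine ⟨fun he ⟨hp, hq⟩ => ?_, fun he => ?_⟩
    · obtain ⟨w, hw⟩ := hp.exists_side
      have w_eq : w = h.side := by
        refine Subtype.ext ?_
        rcases hw with rfl | rfl
        · exact hq.resolve_right h.adj_base.ne.symm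
        · exact hq.resolve_left h.adj_base.ne.symm
      subst w_eq
      exact hw.elim (he ()).1 (he ()).2
    · rintro -
      refine ⟨?_, ?_⟩ <;> rintro rfl
      · exact he ⟨.inr rfl, .inl rfl⟩
      · exact he ⟨.inl rfl, .inr rfl⟩
  · rw [plaquettePatch_avoidsFace, plaquettePatch_avoidsFace, ← not_and_or]
    refine ⟨fun ht ⟨hp, hq⟩ => ?_, fun ht => ?_⟩
    · obtain ⟨c, rfl⟩ := Face.exists_corner hp
      obtain rfl | rfl := (h.mem_face_iff c).mp hq
      · exact ht false rfl
      · exact ht true rfl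
    · rintro (_ | _) rfl
      · exact ht ⟨Corner.mem_face _, (h.mem_face_iff _).mpr (.inl rfl)⟩
      · exact ht ⟨Corner.mem_face _, (h.mem_face_iff _).mpr (.inr rfl)⟩

variable {D}

section Relabel

variable (B : D.Labeling S) (x : D.A) (c c' : ℕ)

/-- The common side relabelled by `x` and its end points by `c` and `c'`. -/
noncomputable def relabel : D.Labeling S :=
  B.relabel h.patch (fun _ => x) fun k => cond k c' c

theorem relabel_side : (h.relabel B x c c').edge h.side.edge = x :=
  relabelEdge_apply h.patch _ _ ()

theorem relabel_side_symm : (h.relabel B x c c').edge h.side.edge.symm =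
    D.dual ((h.relabel B x c c').edge h.side.edge) :=
  (relabelEdge_symm h.patch _ _ ()).trans (congrArg D.dual (h.relabel_side B x c c').symm)

theorem relabel_left : (h.relabel B x c c').vert h.cornerLeft.face = c :=
  B.relabel_vert_apply h.patch _ _ false

theorem relabel_right : (h.relabel B x c c').vert h.cornerRight.face = c' :=
  B.relabel_vert_apply h.patch _ _ true

end Relabel

/-- The labels of a labeling around the common side. -/
def labels (L : D.Labeling S) : D.EdgeLabels :=
  ⟨L.edge h.side.edge, L.edge h.sideLeft.edge, L.edge h.sideRight.edge,
    L.edge h.swap.sideLeft.edge, L.edge h.swap.sideRight.edge, L.vert h.cornerLeft.face,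
    L.vert h.cornerRight.face⟩

theorem labels_swap {L : D.Labeling S}
    (hL : L.edge h.side.edge.symm = D.dual (L.edge h.side.edge)) :
    h.swap.labels L = (h.labels L).swap := by
  simp only [labels, EdgeLabels.swap, face_cornerLeft h, face_cornerRight h, ← hL]
  rfl

end Diamond

end Diamond

section Split

open Finset

theorem sum_piFinset_unit {β R : Type*} [AddCommMonoid R] (t : Unit → Finset β)
    (f : (Unit → β) → R) : ∑ a ∈ Fintype.piFinset t, f a = ∑ x ∈ t (), f fun _ => x := by
  refine sum_nbij' (fun a => a ()) (fun x _ => x) ?_ ?_ ?_ ?_ ?_ <;>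
    simp +contextual [Fintype.mem_piFinset]

theorem sum_piFinset_bool {β R : Type*} [AddCommMonoid R] (t : Bool → Finset β)
    (f : (Bool → β) → R) : ∑ a ∈ Fintype.piFinset t, f a =
      ∑ x ∈ t false, ∑ y ∈ t true, f fun k => cond k y x := by
  have cond_eq (a : Bool → β) : (fun k => cond k (a true) (a false)) = a :=
    funext fun k => by cases k <;> rfl
  rw [← sum_product']
  refine sum_nbij' (fun a => (a false, a true)) (fun x k => cond k x.2 x.1) ?_ ?_ ?_ ?_ ?_
  · exact fun a ha => mem_product.mpr ⟨Fintype.mem_piFinset.mp ha _, Fintype.mem_piFinset.mp ha _⟩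
  · rintro ⟨x, y⟩ h
    rw [Fintype.mem_piFinset]
    rintro (_ | _)
    exacts [(mem_product.mp h).1, (mem_product.mp h).2]
  · exact fun a _ => cond_eq a
  · exact fun _ _ => rfl
  · exact fun a _ => congrArg f (cond_eq a).symm

theorem sum_mul_sum_eq_sum_sum_mul_sum {ι α β R : Type*} [CommSemiring R] (u : Finset ι)
    (s : Finset α) (t : Finset β) (r : α → R) (r' : β → R) (f : ι → α → R) (g : ι → β → R) :
    ∑ i ∈ u, (∑ a ∈ s, r a * f i a) * ∑ b ∈ t, r' b * g i b =
      ∑ a ∈ s, ∑ b ∈ t, r a * r' b * ∑ i ∈ u, f i a * g i b := by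
  simp only [sum_mul_sum]
  simp only [mul_sum]
  rw [sum_comm]
  refine sum_congr rfl fun a _ => ?_
  rw [sum_comm]
  exact sum_congr rfl fun b _ => sum_congr rfl fun i _ => by ring

theorem sum_piFinset_update {W β R : Type*} [Fintype W] [DecidableEq W] [AddCommMonoid R]
    (t : W → Finset β) (e : W) (z : β) (f : (W → β) → R) :
    ∑ a ∈ Fintype.piFinset t, f a =
      ∑ a ∈ Fintype.piFinset fun w => if w = e then {z} else t w,
        ∑ x ∈ t e, f (Function.update a e x) := by
  rw [← sum_product']
  refine sum_nbij' (fun a => (Function.update a e z, a e)) (fun x => Function.update x.1 e x.2)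
    ?_ ?_ ?_ ?_ ?_
  · intro a ha
    simp only [mem_product, Fintype.mem_piFinset] at ha ⊢
    refine ⟨fun w => ?_, ha e⟩
    obtain rfl | hw := eq_or_ne w e
    · simp
    · simpa [hw] using ha w
  · rintro ⟨a, x⟩ ha
    simp only [mem_product, Fintype.mem_piFinset] at ha ⊢
    intro w
    obtain rfl | hw := eq_or_ne w e
    · simpa using ha.2
    · simpa [hw] using ha.1 w
  · exact fun a _ => by simp
  · rintro ⟨a, x⟩ ha
    simp only [mem_product, Fintype.mem_piFinset] at ha
    have a_eq : a e = z := by simpa using ha.1 e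
    simp [← a_eq]
  · exact fun a _ => by simp

theorem loopSum_eq_sum_mul_sum {R W K α : Type*} [CommSemiring R] [Fintype W] [DecidableEq W]
    [Fintype K] (inn out : K ≃ W) (A : W → Finset α) (F : K → α → α → R)
    {k₁ k₂ : K} (hne : k₁ ≠ k₂) (h : out k₁ = inn k₂) {T : Finset K}
    (hT : ∀ k, k ∉ T ↔ k = k₁ ∨ k = k₂) (z : α) :
    loopSum inn out A F =
      ∑ a ∈ Fintype.piFinset fun w => if w = inn k₂ then {z} else A w,
        (∏ k ∈ T, F k (a (inn k)) (a (out k))) *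
          ∑ x ∈ A (inn k₂), F k₁ (a (inn k₁)) x * F k₂ x (a (out k₂)) := by
  classical
  have compl_eq : Tᶜ = {k₁, k₂} := by
    ext k
    rw [mem_compl, hT, mem_insert, mem_singleton]
  have inn_ne {k : K} (hk : k ≠ k₂) : inn k ≠ inn k₂ := inn.injective.ne hk
  have out_ne {k : K} (hk : k ≠ k₁) : out k ≠ inn k₂ := h ▸ out.injective.ne hk
  rw [loopSum, sum_piFinset_update A (inn k₂) z]
  refine sum_congr rfl fun a _ => ?_
  rw [mul_sum]
  refine sum_congr rfl fun x _ => ?_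
  rw [← prod_mul_prod_compl T, compl_eq, prod_pair hne, h, Function.update_self,
    Function.update_of_ne (inn_ne hne), Function.update_of_ne (out_ne hne.symm)]
  refine congrArg (· * _) (prod_congr rfl fun k hk => ?_)
  rw [Function.update_of_ne (inn_ne fun e => (hT k).mpr (.inr e) hk),
    Function.update_of_ne (out_ne fun e => (hT k).mpr (.inl e) hk)]

end Split

section Commutation

variable [Fintype V] {D} {p q u v : V} {s t : D.A}

open Finset

/-- The factor of `boundaryCoeff` at a corner of the plaquette. -/
def cornerFactor (s : D.A) (L' L : D.Labeling S) (c : S.Corner p) : ℕ → ℕ → 𝕜 :=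
  D.cornerCoeff (L.edge c.outer) s (L'.edge c.sideIn.edge) (L'.edge c.sideOut.edge)
    (L.edge c.sideIn.edge) (L.edge c.sideOut.edge) (L'.vert c.face) (L.vert c.face)

/-- The range of the summation index of `boundaryCoeff` at a side of the plaquette. -/
def sideRange (s : D.A) (L' L : D.Labeling S) (w : S.Side p) : Finset ℕ :=
  Icc 1 (D.δ (L'.edge w.edge) s (D.dual (L.edge w.edge)))

theorem boundaryCoeff_eq_loopSum (L' L : D.Labeling S) : D.boundaryCoeff p s L' L =
    loopSum (inEquiv S p) (outEquiv S p) (sideRange s L' L) (cornerFactor s L' L) := rfl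

/-- The product of the factors of `boundaryCoeff` at the corners away from `q`. -/
noncomputable def restCoeff (q : V) (s : D.A) (L' L : D.Labeling S) (a : S.Side p → ℕ) : 𝕜 :=
  ∏ c : S.Corner p with q ∉ c.face.1, cornerFactor s L' L c (a c.sideIn) (a c.sideOut)

/-- The ranges of the summation indices of `boundaryCoeff` at the sides not shared with `q`. -/
def restRange (q : V) (s : D.A) (L' L : D.Labeling S) (w : S.Side p) : Finset ℕ :=
  if w.1 = q then {0} else sideRange s L' L w

theorem Diamond.boundaryCoeff_eq (h : Diamond S p q u v) {L' L : D.Labeling S}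
    (hL : L.edge h.swap.sideLeft.edge.symm = D.dual (L.edge h.swap.sideLeft.edge)) :
    D.boundaryCoeff p s L' L = ∑ a ∈ Fintype.piFinset (restRange (p := p) q s L' L),
      restCoeff q s L' L a *
        sideCoeff s (h.labels L') (h.labels L) (a h.sideLeft) (a h.sideRight) := by
  have mem_rest (c : S.Corner p) : c ∉ univ.filter (fun c : S.Corner p => q ∉ c.face.1) ↔
      c = h.cornerLeft ∨ c = h.cornerRight := by simp [← h.mem_face_iff]
  have range_eq : restRange q s L' L = fun w : S.Side p =>
      if w = inEquiv S p h.cornerRight then {0} else sideRange s L' L w :=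
    funext fun w => if_congr (Subtype.ext_iff (a1 := w) (a2 := h.side)).symm rfl rfl
  have outer_eq : L.edge h.cornerRight.outer = D.dual (L.edge h.swap.sideLeft.edge) := hL
  have sideCoeff_eq (a a' : ℕ) : ∑ x ∈ sideRange s L' L h.side,
      cornerFactor s L' L h.cornerLeft a x * cornerFactor s L' L h.cornerRight x a' =
      sideCoeff s (h.labels L') (h.labels L) a a' := by
    simp only [cornerFactor, outer_eq]
    rfl
  rw [boundaryCoeff_eq_loopSum, loopSum_eq_sum_mul_sum (inEquiv S p) (outEquiv S p) _ _
    h.cornerLeft_ne_cornerRight rfl mem_rest 0, range_eq]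
  exact sum_congr rfl fun a _ => congrArg (_ * ·) (sideCoeff_eq _ _)

section Congruence

variable {L' L M' M : D.Labeling S}

omit [Fintype V]

theorem cornerFactor_congr (h' : L'.EqOff (plaquettePatch S q) M')
    (h : L.EqOff (plaquettePatch S q) M) {c : S.Corner p} (hc : q ∉ c.face.1) :
    cornerFactor s L' L c = cornerFactor s M' M c := by
  have avoidsFace : (plaquettePatch S q).AvoidsFace c.flag.face :=
    plaquettePatch_avoidsFace.mpr hc
  have avoidsOut : (plaquettePatch S q).AvoidsEdge c.sideOut.edge := avoidsFace.avoidsEdge.symm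
  have avoidsOuter : (plaquettePatch S q).AvoidsEdge c.outer := avoidsFace.rotate.avoidsEdge.symm
  have avoidsIn : (plaquettePatch S q).AvoidsEdge c.sideIn.edge :=
    avoidsFace.rotate.rotate.avoidsEdge
  rw [cornerFactor, cornerFactor, h.edge _ avoidsOuter, h'.edge _ avoidsIn, h'.edge _ avoidsOut,
    h.edge _ avoidsIn, h.edge _ avoidsOut, h'.vert c.face avoidsFace, h.vert c.face avoidsFace]

theorem sideRange_congr (hpq : p ≠ q) (h' : L'.EqOff (plaquettePatch S q) M')
    (h : L.EqOff (plaquettePatch S q) M) {w : S.Side p} (hw : w.1 ≠ q) :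
    sideRange s L' L w = sideRange s M' M w := by
  have avoids : (plaquettePatch S q).AvoidsEdge w.edge :=
    plaquettePatch_avoidsEdge.mpr (not_or.mpr ⟨hw, hpq⟩)
  rw [sideRange, sideRange, h.edge _ avoids, h'.edge _ avoids]

theorem restRange_congr (hpq : p ≠ q) (h' : L'.EqOff (plaquettePatch S q) M')
    (h : L.EqOff (plaquettePatch S q) M) :
    restRange (p := p) q s L' L = restRange q s M' M :=
  funext fun _ => ite_congr rfl (fun _ => rfl) (sideRange_congr hpq h' h)

end Congruence

theorem restCoeff_congr {L' L M' M : D.Labeling S} (h' : L'.EqOff (plaquettePatch S q) M')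
    (h : L.EqOff (plaquettePatch S q) M) :
    restCoeff (p := p) q s L' L = restCoeff q s M' M :=
  funext fun _ => prod_congr rfl fun _ hc => by
    rw [cornerFactor_congr h' h (mem_filter.mp hc).2]

section Middle

variable {Φ₀ Φ₁ Φ₂ : S.Coloring G} {σ₂ : D.State Φ₂} {σ₀ : D.State Φ₀} {L : D.Labeling S}
  (h : Diamond S p q u v) (h₂ : σ₂.toLabeling.EqOff (plaquettePatch S p) L)
  (h₀ : L.EqOff (plaquettePatch S q) σ₀.toLabeling)

namespace Diamond

section

omit [Fintype V]

include h h₀ in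
theorem edge_eq_of_ne_right {w : S.Side p} (hw : w.1 ≠ q) :
    L.edge w.edge = σ₀.edge w.edge ∧ L.edge w.edge.symm = D.dual (σ₀.edge w.edge) := by
  have avoids : (plaquettePatch S q).AvoidsEdge w.edge :=
    plaquettePatch_avoidsEdge.mpr (not_or.mpr ⟨hw, h.adj_base.ne.symm⟩)
  exact ⟨h₀.edge _ avoids, (h₀.edge _ avoids.symm).trans (σ₀.edge_symm _)⟩

include h h₂ in
theorem edge_eq_of_ne_left {w : S.Side q} (hw : w.1 ≠ p) :
    L.edge w.edge = σ₂.edge w.edge ∧ L.edge w.edge.symm = D.dual (σ₂.edge w.edge) := by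
  have avoids : (plaquettePatch S p).AvoidsEdge w.edge :=
    plaquettePatch_avoidsEdge.mpr (not_or.mpr ⟨hw, h.adj_base.ne⟩)
  exact ⟨(h₂.edge _ avoids).symm, (h₂.edge _ avoids.symm).symm.trans (σ₂.edge_symm _)⟩

include h₂ h₀

theorem labels_eq_middle : h.labels L = (h.labels σ₂.toLabeling).middle (h.labels σ₀.toLabeling)
    (L.edge h.side.edge) (L.vert h.cornerLeft.face) (L.vert h.cornerRight.face) := by
  have in₁_eq := (h.edge_eq_of_ne_right h₀ (w := h.sideLeft) h.adj_left_snd.ne).1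
  have out₁_eq := (h.edge_eq_of_ne_right h₀ (w := h.sideRight) h.swap.adj_left_fst.ne).1
  have in₂_eq := (h.edge_eq_of_ne_left h₂ (w := h.swap.sideLeft) h.swap.adj_left_snd.ne).1
  have out₂_eq := (h.edge_eq_of_ne_left h₂ (w := h.swap.sideRight) h.adj_left_fst.ne).1
  rw [labels, in₁_eq, out₁_eq, in₂_eq, out₂_eq]
  rfl

variable (symm : L.edge h.side.edge.symm = D.dual (L.edge h.side.edge))

include symm

theorem mult_cornerLeft : D.mult L.edge h.cornerLeft.flag =
    D.δ (D.dual (L.edge h.side.edge)) (D.dual (σ₂.edge h.swap.sideRight.edge))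
      (σ₀.edge h.sideLeft.edge) := by
  have e₁_eq : L.edge h.cornerLeft.flag.e₁ = D.dual (L.edge h.side.edge) := symm
  have e₂_eq : L.edge h.cornerLeft.flag.e₂ = D.dual (σ₂.edge h.swap.sideRight.edge) :=
    (h.edge_eq_of_ne_left h₂ (w := h.swap.sideRight) h.adj_left_fst.ne).2
  have e₃_eq : L.edge h.cornerLeft.flag.e₃ = σ₀.edge h.sideLeft.edge :=
    (h.edge_eq_of_ne_right h₀ (w := h.sideLeft) h.adj_left_snd.ne).1
  rw [mult, e₁_eq, e₂_eq, e₃_eq]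

omit symm in
theorem mult_cornerRight : D.mult L.edge h.cornerRight.flag =
    D.δ (L.edge h.side.edge) (D.dual (σ₀.edge h.sideRight.edge))
      (σ₂.edge h.swap.sideLeft.edge) := by
  have e₁_eq : L.edge h.cornerRight.flag.e₁ = D.dual (σ₀.edge h.sideRight.edge) :=
    (h.edge_eq_of_ne_right h₀ (w := h.sideRight) h.swap.adj_left_fst.ne).2
  have e₂_eq : L.edge h.cornerRight.flag.e₂ = σ₂.edge h.swap.sideLeft.edge :=
    (h.edge_eq_of_ne_left h₂ (w := h.swap.sideLeft) h.swap.adj_left_snd.ne).1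
  rw [mult, e₁_eq, e₂_eq, ← D.δ_rotate]
  rfl

end

include h₂ h₀ in
theorem boundaryCoeff_mul_boundaryCoeff
    (symm : L.edge h.side.edge.symm = D.dual (L.edge h.side.edge)) :
    D.boundaryCoeff p s σ₂.toLabeling L * D.boundaryCoeff q t L σ₀.toLabeling =
      (∑ a ∈ Fintype.piFinset (restRange (p := p) q s σ₂.toLabeling σ₀.toLabeling),
        restCoeff q s σ₂.toLabeling σ₀.toLabeling a *
          sideCoeff s (h.labels σ₂.toLabeling) (h.labels L) (a h.sideLeft) (a h.sideRight)) *
      ∑ b ∈ Fintype.piFinset (restRange (p := q) p t σ₂.toLabeling σ₀.toLabeling),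
        restCoeff p t σ₂.toLabeling σ₀.toLabeling b *
          sideCoeff t (h.labels L).swap (h.labels σ₀.toLabeling).swap (b h.swap.sideLeft)
            (b h.swap.sideRight) := by
  have in₂_eq := h.edge_eq_of_ne_left h₂ (w := h.swap.sideLeft) h.swap.adj_left_snd.ne
  rw [h.boundaryCoeff_eq (in₂_eq.2.trans (congrArg D.dual in₂_eq.1.symm)),
    h.swap.boundaryCoeff_eq (σ₀.edge_symm _),
    restRange_congr h.adj_base.ne.symm (Labeling.EqOff.refl _ _) h₀,
    restCoeff_congr (Labeling.EqOff.refl _ _) h₀,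
    restRange_congr h.adj_base.ne h₂.symm (Labeling.EqOff.refl _ _),
    restCoeff_congr h₂.symm (Labeling.EqOff.refl _ _), h.labels_swap symm,
    h.labels_swap (L := σ₀.toLabeling) (σ₀.edge_symm _)]

end Diamond

variable {g : G}

theorem sum_stringCoeff_mul_of_diamond (hΦ₁ : Φ₁ = Φ₀ + S.plaquetteColoring g q)
    (hΦ₂ : Φ₂ = Φ₁ + S.plaquetteColoring (D.deg s) p)
    (hσ : σ₂.toLabeling.EqOffBoth (plaquettePatch S p) (plaquettePatch S q) σ₀.toLabeling) :
    ∑ σ₁ : D.State Φ₁, D.stringCoeff p s σ₂ σ₁ * D.stringCoeff q t σ₁ σ₀ =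
      ∑ a ∈ Fintype.piFinset (restRange (p := p) q s σ₂.toLabeling σ₀.toLabeling),
        ∑ b ∈ Fintype.piFinset (restRange (p := q) p t σ₂.toLabeling σ₀.toLabeling),
          restCoeff q s σ₂.toLabeling σ₀.toLabeling a *
            restCoeff p t σ₂.toLabeling σ₀.toLabeling b *
              edgeCoeff s t (h.labels σ₂.toLabeling) (h.labels σ₀.toLabeling) (a h.sideLeft)
                (a h.sideRight) (b h.swap.sideLeft) (b h.swap.sideRight) := by
  set B := Labeling.patch (plaquettePatch S q) σ₂.toLabeling σ₀.toLabeling with hB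
  have eqOff (x : D.A) (c c' : ℕ) : σ₂.toLabeling.EqOff (plaquettePatch S p) (h.relabel B x c c') ∧
      (h.relabel B x c c').EqOff (plaquettePatch S q) σ₀.toLabeling :=
    (h.isInter_patch.eqOff_and_eqOff_iff hσ).mpr (Labeling.relabel_eqOff _ _ _ _)
  have symm (x : D.A) (c c' : ℕ) := h.relabel_side_symm B x c c'
  have mult_left (x : D.A) := h.mult_cornerLeft (eqOff x 0 0).1 (eqOff x 0 0).2 (symm x 0 0)
  have mult_right (x : D.A) := h.mult_cornerRight (eqOff x 0 0).1 (eqOff x 0 0).2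
  have labels_eq (x : D.A) (c c' : ℕ) := h.labels_eq_middle (eqOff x c c').1 (eqOff x c c').2
  have mul_eq (x : D.A) (c c' : ℕ) := h.boundaryCoeff_mul_boundaryCoeff (s := s) (t := t)
    (eqOff x c c').1 (eqOff x c c').2 (symm x c c')
  have val_eq : Φ₁.val h.side.edge = D.deg (σ₂.edge h.side.edge) + D.deg s := by
    rw [σ₂.deg_edge, h.side.val_edge_of_eq_add hΦ₂, sub_add_cancel]
  simp only [h.relabel_side, h.relabel_left, h.relabel_right] at mult_left mult_right labels_eq
  simp only [labels_eq] at mul_eq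
  calc ∑ σ₁ : D.State Φ₁, D.stringCoeff p s σ₂ σ₁ * D.stringCoeff q t σ₁ σ₀
      = ∑ x ∈ D.I (D.deg (σ₂.edge h.side.edge) + D.deg s),
          ∑ c ∈ Icc 1 (D.δ (D.dual x) (D.dual (σ₂.edge h.swap.sideRight.edge))
            (σ₀.edge h.sideLeft.edge)),
          ∑ c' ∈ Icc 1 (D.δ x (D.dual (σ₀.edge h.sideRight.edge)) (σ₂.edge h.swap.sideLeft.edge)),
            D.boundaryCoeff p s σ₂.toLabeling (h.relabel B x c c') *
              D.boundaryCoeff q t (h.relabel B x c c') σ₀.toLabeling := by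
        rw [sum_stringCoeff_mul_eq_sum_relabel h.isInter_patch hΦ₁ hΦ₂ hσ hB]
        simp only [sum_piFinset_unit, sum_piFinset_bool, ← mult_left, ← mult_right, ← val_eq]
        rfl
    _ = _ := by
        simp only [mul_eq, sum_sigma']
        simp only [sum_mul_sum_eq_sum_sum_mul_sum, edgeCoeff, sum_sigma']
        rfl

end Middle

section NotAdj

variable (S) in
/-- The patch without edges and vertices. -/
def emptyPatch : S.Patch Empty Empty where
  edge := Empty.elim
  flag := Empty.elim
  edge_injective := fun i => i.elim
  edge_ne_symm := fun i => i.elim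
  face_injective := fun i => i.elim
  exists_face_eq := fun i => i.elim

variable (hpq : p ≠ q) (hadj : ¬ S.graph.Adj q p)

include hpq hadj

omit [Fintype V] in
theorem Corner.notMem_face_of_not_adj (c : S.Corner p) : q ∉ c.face.1 := by
  simp only [Corner.face, Flag.face, Finset.mem_insert, Finset.mem_singleton, not_or]
  exact ⟨hpq.symm, fun h => hadj (h ▸ c.sideOut.2), fun h => hadj (h ▸ c.sideIn.2)⟩

omit [Fintype V] in
theorem isInter_emptyPatch :
    IsInter (emptyPatch S) (plaquettePatch S p) (plaquettePatch S q) := by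
  refine ⟨fun e => iff_of_true (fun i => i.elim) ?_, fun t => iff_of_true (fun i => i.elim) ?_⟩
  · rw [plaquettePatch_avoidsEdge, plaquettePatch_avoidsEdge, ← not_and_or]
    rintro ⟨hp, hq⟩
    obtain ⟨w, rfl | rfl⟩ := hp.exists_side
    · exact hadj (hq.resolve_right hpq ▸ w.2)
    · exact hadj (hq.resolve_left hpq ▸ w.2)
  · rw [plaquettePatch_avoidsFace, plaquettePatch_avoidsFace, ← not_and_or]
    rintro ⟨hp, hq⟩
    obtain ⟨c, rfl⟩ := Face.exists_corner hp
    exact Corner.notMem_face_of_not_adj hpq hadj c hq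

theorem boundaryCoeff_congr {L' L M' M : D.Labeling S} (h' : L'.EqOff (plaquettePatch S q) M')
    (h : L.EqOff (plaquettePatch S q) M) : D.boundaryCoeff p s L' L = D.boundaryCoeff p s M' M := by
  have range_eq : sideRange (p := p) s L' L = sideRange s M' M :=
    funext fun w => sideRange_congr hpq h' h fun hw => hadj (hw ▸ w.2)
  have factor_eq : cornerFactor (p := p) s L' L = cornerFactor s M' M :=
    funext fun c => cornerFactor_congr h' h (Corner.notMem_face_of_not_adj hpq hadj c)
  rw [boundaryCoeff_eq_loopSum, boundaryCoeff_eq_loopSum, range_eq, factor_eq]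

theorem sum_stringCoeff_mul_of_not_adj {Φ₀ Φ₁ Φ₂ : S.Coloring G} {σ₂ : D.State Φ₂}
    {σ₀ : D.State Φ₀} {g h : G} (hΦ₁ : Φ₁ = Φ₀ + S.plaquetteColoring g q)
    (hΦ₂ : Φ₂ = Φ₁ + S.plaquetteColoring h p)
    (hσ : σ₂.toLabeling.EqOffBoth (plaquettePatch S p) (plaquettePatch S q) σ₀.toLabeling) :
    ∑ σ₁ : D.State Φ₁, D.stringCoeff p s σ₂ σ₁ * D.stringCoeff q t σ₁ σ₀ =
      D.boundaryCoeff p s σ₂.toLabeling σ₀.toLabeling *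
        D.boundaryCoeff q t σ₂.toLabeling σ₀.toLabeling := by
  have isInter := isInter_emptyPatch hpq hadj
  set B := Labeling.patch (plaquettePatch S q) σ₂.toLabeling σ₀.toLabeling with hB
  have mul_eq (j : Empty → D.A) (C : Empty → ℕ) :
      D.boundaryCoeff p s σ₂.toLabeling (B.relabel (emptyPatch S) j C) *
        D.boundaryCoeff q t (B.relabel (emptyPatch S) j C) σ₀.toLabeling =
      D.boundaryCoeff p s σ₂.toLabeling σ₀.toLabeling *
        D.boundaryCoeff q t σ₂.toLabeling σ₀.toLabeling := by
    obtain ⟨h₂, h₀⟩ := (isInter.eqOff_and_eqOff_iff hσ).mpr (Labeling.relabel_eqOff _ _ j C)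
    rw [boundaryCoeff_congr hpq hadj (Labeling.EqOff.refl _ _) h₀,
      boundaryCoeff_congr hpq.symm (mt SimpleGraph.Adj.symm hadj) h₂.symm
        (Labeling.EqOff.refl _ _)]
  rw [sum_stringCoeff_mul_eq_sum_relabel isInter hΦ₁ hΦ₂ hσ hB]
  simp only [mul_eq, Fintype.piFinset_of_isEmpty, univ_unique, sum_singleton]

end NotAdj

section Square

variable {Φ₀ Φ₁ Φ₁' Φ₂ : S.Coloring G} (admissible : D.Admissible Φ₁)
  (admissible' : D.Admissible Φ₁') (hpq : p ≠ q)

include admissible admissible' hpq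

theorem sum_stringCoeff_comm {σ₂ : D.State Φ₂} {σ₀ : D.State Φ₀}
    (hΦ₁ : Φ₁ = Φ₀ + S.plaquetteColoring (D.deg t) q)
    (hΦ₂ : Φ₂ = Φ₁ + S.plaquetteColoring (D.deg s) p)
    (hΦ₁' : Φ₁' = Φ₀ + S.plaquetteColoring (D.deg s) p)
    (hΦ₂' : Φ₂ = Φ₁' + S.plaquetteColoring (D.deg t) q) :
    ∑ σ₁ : D.State Φ₁, D.stringCoeff p s σ₂ σ₁ * D.stringCoeff q t σ₁ σ₀ =
      ∑ σ₁ : D.State Φ₁', D.stringCoeff q t σ₂ σ₁ * D.stringCoeff p s σ₁ σ₀ := by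
  by_cases hσ :
    σ₂.toLabeling.EqOffBoth (plaquettePatch S p) (plaquettePatch S q) σ₀.toLabeling
  swap
  · rw [sum_stringCoeff_mul_eq_zero hσ,
      sum_stringCoeff_mul_eq_zero (mt Labeling.eqOffBoth_comm.mpr hσ)]
  have hσ' := Labeling.eqOffBoth_comm.mp hσ
  by_cases hadj : S.graph.Adj p q
  swap
  · rw [sum_stringCoeff_mul_of_not_adj hpq (mt SimpleGraph.Adj.symm hadj) hΦ₁ hΦ₂ hσ,
      sum_stringCoeff_mul_of_not_adj hpq.symm hadj hΦ₁' hΦ₂' hσ', mul_comm]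
  obtain ⟨u, v, h⟩ := Diamond.exists_of_adj hadj
  have side_add_notMem : D.deg (σ₂.edge h.side.edge) + D.deg s ∉ D.X := by
    rw [σ₂.deg_edge, h.side.val_edge_of_eq_add hΦ₂, sub_add_cancel]
    exact admissible _
  have dual_side_add_notMem : D.deg (D.dual (σ₂.edge h.side.edge)) + D.deg t ∉ D.X := by
    rw [← σ₂.edge_symm, σ₂.deg_edge, show h.side.edge.symm = h.swap.side.edge from rfl,
      h.swap.side.val_edge_of_eq_add hΦ₂', sub_add_cancel]
    exact admissible' _
  rw [sum_stringCoeff_mul_of_diamond h hΦ₁ hΦ₂ hσ,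
    sum_stringCoeff_mul_of_diamond h.swap hΦ₁' hΦ₂' hσ', sum_comm]
  refine sum_congr rfl fun b _ => sum_congr rfl fun a _ => ?_
  rw [h.labels_swap (L := σ₂.toLabeling) (σ₂.edge_symm _),
    h.labels_swap (L := σ₀.toLabeling) (σ₀.edge_symm _),
    edgeCoeff_swap side_add_notMem dual_side_add_notMem, mul_comm (restCoeff q s _ _ a)]

theorem gradedPlaquetteOp_comm {g h : G} (hΦ₁ : Φ₁ = Φ₀ + S.plaquetteColoring h q)
    (hΦ₂ : Φ₂ = Φ₁ + S.plaquetteColoring g p) (hΦ₁' : Φ₁' = Φ₀ + S.plaquetteColoring g p)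
    (hΦ₂' : Φ₂ = Φ₁' + S.plaquetteColoring h q) :
    D.gradedPlaquetteOp p g Φ₁ Φ₂ ∘ₗ D.gradedPlaquetteOp q h Φ₀ Φ₁ =
      D.gradedPlaquetteOp q h Φ₁' Φ₂ ∘ₗ D.gradedPlaquetteOp p g Φ₀ Φ₁' := by
  classical
  simp only [gradedPlaquetteOp, sum_smul_comp_sum_smul]
  rw [sum_comm]
  refine sum_congr rfl fun t ht => sum_congr rfl fun s hs => ?_
  obtain rfl := D.mem_I.mp hs
  obtain rfl := D.mem_I.mp ht
  rw [mul_comm (D.b s)]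
  refine congrArg _ ?_
  simp only [stringOp, ← Matrix.mulVecLin_mul]
  refine congrArg Matrix.mulVecLin (Matrix.ext fun σ₂ σ₀ => ?_)
  exact sum_stringCoeff_comm admissible admissible' hpq hΦ₁ hΦ₂ hΦ₁' hΦ₂'

end Square

theorem plaquetteOp_comm {Φ : S.Coloring G} {g h : G} (admissible : D.Admissible Φ)
    (hg : D.GenericAt Φ p g) (hh : D.GenericAt Φ q h) :
    D.plaquetteOp Φ p g * D.plaquetteOp Φ q h = D.plaquetteOp Φ q h * D.plaquetteOp Φ p g := by
  obtain rfl | hpq := eq_or_ne p q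
  · rw [plaquetteOp_eq admissible hg hh]
  obtain ⟨k, hk, hk', -⟩ := D.exists_genericAt admissible hg.2 q Set.finite_empty
  rw [plaquetteOp_eq admissible hh hk, Module.End.mul_eq_comp, Module.End.mul_eq_comp, plaquetteOp,
    plaquetteOp]
  set Φp := Φ + S.plaquetteColoring (-g) p with hΦp
  set Φq := Φ + S.plaquetteColoring (-k) q with hΦq
  set Φpq := Φp + S.plaquetteColoring (-k) q with hΦpq
  have admissible_p : D.Admissible Φp := hg.2
  have admissible_q : D.Admissible Φq := hk.2
  have admissible_pq : D.Admissible Φpq := hk'.2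
  have hp : Φ = Φp + S.plaquetteColoring g p := add_plaquetteColoring_neg_add.symm
  have hq : Φ = Φq + S.plaquetteColoring k q := add_plaquetteColoring_neg_add.symm
  have hΦp' : Φp = Φpq + S.plaquetteColoring k q := add_plaquetteColoring_neg_add.symm
  have hΦpq' : Φpq = Φq + S.plaquetteColoring (-g) p := add_plaquetteColoring_comm
  have hΦq' : Φq = Φpq + S.plaquetteColoring g p := by
    rw [hΦpq', add_plaquetteColoring_neg_add]
  calc (D.gradedPlaquetteOp p g Φp Φ ∘ₗ D.gradedPlaquetteOp p (-g) Φ Φp) ∘ₗ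
        D.gradedPlaquetteOp q k Φq Φ ∘ₗ D.gradedPlaquetteOp q (-k) Φ Φq
      = D.gradedPlaquetteOp p g Φp Φ ∘ₗ (D.gradedPlaquetteOp p (-g) Φ Φp ∘ₗ
          D.gradedPlaquetteOp q k Φq Φ) ∘ₗ D.gradedPlaquetteOp q (-k) Φ Φq := by
        simp only [LinearMap.comp_assoc]
    _ = (D.gradedPlaquetteOp p g Φp Φ ∘ₗ D.gradedPlaquetteOp q k Φpq Φp) ∘ₗ
          D.gradedPlaquetteOp p (-g) Φq Φpq ∘ₗ D.gradedPlaquetteOp q (-k) Φ Φq := by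
        rw [gradedPlaquetteOp_comm admissible admissible_pq hpq hq hΦp hΦpq' hΦp']
        simp only [LinearMap.comp_assoc]
    _ = D.gradedPlaquetteOp q k Φq Φ ∘ₗ (D.gradedPlaquetteOp p g Φpq Φq ∘ₗ
          D.gradedPlaquetteOp q (-k) Φp Φpq) ∘ₗ D.gradedPlaquetteOp p (-g) Φ Φp := by
        rw [gradedPlaquetteOp_comm admissible_q admissible_p hpq hΦq hΦpq' hΦp hΦpq,
          gradedPlaquetteOp_comm admissible_p admissible_q hpq hΦp' hp hΦq' hq]
        simp only [LinearMap.comp_assoc]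
    _ = (D.gradedPlaquetteOp q k Φq Φ ∘ₗ D.gradedPlaquetteOp q (-k) Φ Φq) ∘ₗ
          D.gradedPlaquetteOp p g Φp Φ ∘ₗ D.gradedPlaquetteOp p (-g) Φ Φp := by
        rw [gradedPlaquetteOp_comm admissible_pq admissible hpq hΦpq hΦq' hp hΦq]
        simp only [LinearMap.comp_assoc]

end Commutation

section Adjoint

open Finset

variable {D}

section LoopSum

variable {R W K α : Type*} [Field R] [Fintype W] [DecidableEq W] [Fintype K] (inn out : K ≃ W)
  (A : W → Finset α)

theorem loopSum_eq_of_gauge {μ : W → α → R} (hμ : ∀ w a, μ w a ≠ 0) {F F' : K → α → α → R}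
    (h : ∀ k a a', μ (inn k) a * F k a a' = μ (out k) a' * F' k a a') :
    loopSum inn out A F = loopSum inn out A F' := by
  refine sum_congr rfl fun a _ => ?_
  have prod_ne_zero : ∏ w, μ w (a w) ≠ 0 := prod_ne_zero_iff.mpr fun w _ => hμ w (a w)
  refine mul_left_cancel₀ prod_ne_zero ?_
  calc (∏ w, μ w (a w)) * ∏ k, F k (a (inn k)) (a (out k))
      = ∏ k, μ (inn k) (a (inn k)) * F k (a (inn k)) (a (out k)) := by
        rw [prod_mul_distrib, inn.prod_comp fun w => μ w (a w)]
    _ = ∏ k, μ (out k) (a (out k)) * F' k (a (inn k)) (a (out k)) :=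
        prod_congr rfl fun k _ => h k _ _
    _ = _ := by rw [prod_mul_distrib, out.prod_comp fun w => μ w (a w)]

theorem prod_mul_loopSum (c : K → R) (F : K → α → α → R) :
    (∏ k, c k) * loopSum inn out A F = loopSum inn out A fun k a a' => c k * F k a a' := by
  simp only [loopSum, mul_sum, prod_mul_distrib]

theorem star_loopSum [StarRing R] (F : K → α → α → R) :
    star (loopSum inn out A F) = loopSum inn out A fun k a a' => star (F k a a') := by
  simp only [loopSum, star_sum, star_prod]

end LoopSum

section CornerCoeff

variable (outer s i' o' i o : D.A) (C' C a a' : ℕ)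

theorem star_cornerCoeff_dual :
    star (D.cornerCoeff outer (D.dual s) i o i' o' C C' a a') =
      D.d i * D.N i' s i (D.dual o) outer (D.dual o') a C C' a' *
        (D.γ i (D.dual s) (D.dual i') a * D.γ i' (D.dual o') (D.dual outer) C' *
          D.γ outer o (D.dual i) C * D.γ o' s (D.dual o) a' *
            (D.β i * D.β s * D.β i' * D.β o' * D.β outer * D.β o)) := by
  rw [cornerCoeff, star_mul', D.star_d, D.star_N, D.N_symm₁ (D.dual (D.dual s)),
    D.N_symm₁ (D.dual i), D.γ_rotate (D.dual i), D.γ_rotate o' s]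
  simp only [D.dual_dual, D.β_dual]
  ring

/-- The gauge factors `γ i' s i* a` at the sides cancel around a loop. -/
theorem cornerCoeff_gauge :
    D.γ i (D.dual s) (D.dual i') a * (D.γ i' (D.dual o') (D.dual outer) C' *
        (D.β i' / D.d i') * D.cornerCoeff outer s i' o' i o C' C a a') =
      D.γ o (D.dual s) (D.dual o') a' * (D.γ i (D.dual o) (D.dual outer) C * (D.β o / D.d i) *
        star (D.cornerCoeff outer (D.dual s) i o i' o' C C' a a')) := by
  rw [star_cornerCoeff_dual, cornerCoeff]
  by_cases hN : D.N i' s i (D.dual o) outer (D.dual o') a C C' a' = 0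
  · simp only [hN, mul_zero, zero_mul]
  obtain ⟨-, ⟨one_le_C, C_le⟩, -, one_le_a', a'_le⟩ := N_ne_zero hN
  have theta_vert := D.γ_theta _ _ _ _ one_le_C C_le
  have theta_side := D.γ_theta _ _ _ _ one_le_a' a'_le
  simp only [D.dual_dual, D.β_dual] at theta_vert theta_side
  rw [D.γ_rotate (D.dual o'), ← D.γ_rotate o'] at theta_side
  have hd := D.d_ne_zero i
  have hd' := D.d_ne_zero i'
  field_simp
  set X := D.γ i' (D.dual o') (D.dual outer) C' * D.β i' * D.γ i (D.dual s) (D.dual i') a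
  linear_combination -X * (theta_vert + D.γ i (D.dual o) (D.dual outer) C *
    D.γ outer o (D.dual i) C * D.β i * D.β o * D.β outer * theta_side)

end CornerCoeff

variable [Fintype V] {p : V}

section BoundaryWeight

variable {s : D.A} {L' L : D.Labeling S}

variable (D) in
/-- The part of the weight of a state carried by the sides and corners of a plaquette. -/
noncomputable def boundaryWeight (p : V) (L : D.Labeling S) : 𝕜 :=
  (∏ c : S.Corner p, D.γ (L.edge c.sideIn.edge) (D.dual (L.edge c.sideOut.edge))
    (D.dual (L.edge c.outer)) (L.vert c.face)) *
    ((∏ w : S.Side p, D.β (L.edge w.edge)) / ∏ w : S.Side p, D.d (L.edge w.edge))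

theorem boundaryWeight_eq_prod (e : S.Corner p ≃ S.Side p) (L : D.Labeling S) :
    D.boundaryWeight p L = ∏ c : S.Corner p,
      D.γ (L.edge c.sideIn.edge) (D.dual (L.edge c.sideOut.edge)) (D.dual (L.edge c.outer))
        (L.vert c.face) * (D.β (L.edge (e c).edge) / D.d (L.edge c.sideIn.edge)) := by
  rw [prod_mul_distrib, prod_div_distrib, e.prod_comp fun w => D.β (L.edge w.edge)]
  exact congrArg (fun x => _ * (_ / x))
    ((inEquiv S p).prod_comp fun w => D.d (L.edge w.edge)).symm

omit [Fintype V] in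
theorem sideRange_dual (w : S.Side p) :
    sideRange (D.dual s) L L' w = sideRange s L' L w := by
  rw [sideRange, sideRange, D.δ_dual, D.dual_dual, D.dual_dual]

theorem boundaryWeight_mul_boundaryCoeff (h : L'.EqOff (plaquettePatch S p) L) :
    D.boundaryWeight p L' * D.boundaryCoeff p s L' L =
      star (D.boundaryCoeff p (D.dual s) L L') * D.boundaryWeight p L := by
  have outer_eq (c : S.Corner p) : L'.edge c.outer = L.edge c.outer :=
    h.edge _ (plaquettePatch_avoidsEdge.mpr c.not_onBoundary_outer)
  rw [mul_comm (star _), boundaryWeight_eq_prod (inEquiv S p),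
    boundaryWeight_eq_prod (outEquiv S p), boundaryCoeff_eq_loopSum, boundaryCoeff_eq_loopSum,
    star_loopSum, prod_mul_loopSum, prod_mul_loopSum,
    funext (sideRange_dual (L := L) (L' := L') (s := s))]
  refine loopSum_eq_of_gauge _ _ _ (fun w a => D.γ_ne_zero (L.edge w.edge) (D.dual s)
    (D.dual (L'.edge w.edge)) a) fun c a a' => ?_
  simp only [cornerFactor, outer_eq]
  exact cornerCoeff_gauge ..

end BoundaryWeight

section Weight

variable {Φ Φ' : S.Coloring G}

theorem prod_corner_face {R : Type*} [CommMonoid R] (p : V) (f : S.Face → R) :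
    ∏ c : S.Corner p, f c.face = ∏ t with p ∈ t.1, f t :=
  prod_nbij (fun c : S.Corner p => c.face) (fun c _ => mem_filter.mpr ⟨mem_univ _, c.mem_face⟩)
    Corner.face_injective.injOn
    (fun _ ht => (Face.exists_corner (mem_filter.mp ht).2).imp fun c hc => ⟨mem_univ c, hc⟩)
    fun _ _ => rfl

theorem prod_side_uedge {R : Type*} [CommMonoid R] (p : V) (f : S.UEdge → R) :
    ∏ w : S.Side p, f ⟨w.edge.edge, w.edge.edge_mem⟩ = ∏ e with p ∈ e.1, f e := by
  refine prod_nbij (fun w => ⟨w.edge.edge, w.edge.edge_mem⟩)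
    (fun w _ => mem_filter.mpr ⟨mem_univ _, Sym2.mem_mk_right w.1 p⟩) ?_ ?_ fun _ _ => rfl
  · exact fun w _ w' _ h => Subtype.ext (Sym2.congr_left.mp (congrArg Subtype.val h))
  · rintro ⟨e, he⟩ hp
    obtain ⟨w, rfl⟩ := Sym2.mem_iff_exists.mp (mem_filter.mp hp).2
    exact ⟨⟨w, he.symm⟩, mem_univ _, Subtype.ext Sym2.eq_swap⟩

omit [Fintype V] in
theorem State.apply_edge_rep (σ : D.State Φ) {f : D.A → 𝕜} (hf : ∀ a, f (D.dual a) = f a)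
    (e : S.OEdge) :
    f (σ.edge (UEdge.rep ⟨e.edge, e.edge_mem⟩)) = f (σ.edge e) := by
  rcases (SimpleGraph.dart_edge_eq_iff _ _).mp (UEdge.edge_rep ⟨e.edge, e.edge_mem⟩) with h | h
  · exact congrArg (fun e => f (σ.edge e)) h
  · exact (congrArg (fun e => f (σ.edge e)) h).trans (by rw [σ.edge_symm, hf])

theorem State.prod_uedge (σ : D.State Φ) {f : D.A → 𝕜} (hf : ∀ a, f (D.dual a) = f a) (p : V) :
    ∏ e : S.UEdge, f (σ.edge e.rep) =
      (∏ w : S.Side p, f (σ.edge w.edge)) * ∏ e : S.UEdge with p ∉ e.1, f (σ.edge e.rep) := by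
  rw [← prod_filter_mul_prod_filter_not univ fun e : S.UEdge => p ∈ e.1, ← prod_side_uedge]
  simp only [σ.apply_edge_rep hf]

theorem State.prod_flagγ (σ : D.State Φ) (p : V) :
    ∏ t : S.Face, σ.flagγ t.rep =
      (∏ c : S.Corner p, D.γ (σ.edge c.sideIn.edge) (D.dual (σ.edge c.sideOut.edge))
        (D.dual (σ.edge c.outer)) (σ.vert c.face)) *
        ∏ t : S.Face with p ∉ t.1, σ.flagγ t.rep := by
  have flagγ_corner (c : S.Corner p) : σ.flagγ c.face.rep =
      D.γ (σ.edge c.sideIn.edge) (D.dual (σ.edge c.sideOut.edge)) (D.dual (σ.edge c.outer))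
        (σ.vert c.face) := by
    rw [σ.flagγ_eq (f' := c.flag) c.face.rep_face, D.γ_rotate, ← σ.edge_symm, ← σ.edge_symm]
    rfl
  rw [← prod_filter_mul_prod_filter_not univ fun t : S.Face => p ∈ t.1, ← prod_corner_face]
  simp only [flagγ_corner]

/-- The part of the weight of a state carried by the edges and vertices away from a plaquette. -/
noncomputable def State.restWeight (σ : D.State Φ) (p : V) : 𝕜 :=
  (∏ t : S.Face with p ∉ t.1, σ.flagγ t.rep) * ((∏ e : S.UEdge with p ∉ e.1, D.β (σ.edge e.rep)) /
    ∏ e : S.UEdge with p ∉ e.1, D.d (σ.edge e.rep))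

theorem State.weight_eq_mul (σ : D.State Φ) (p : V) :
    σ.weight = D.boundaryWeight p σ.toLabeling * σ.restWeight p := by
  rw [State.weight, σ.prod_flagγ p, σ.prod_uedge D.β_dual p, σ.prod_uedge D.d_dual p, mul_div_assoc,
    mul_div_mul_comm, mul_mul_mul_comm]
  rfl

theorem State.restWeight_congr {σ' : D.State Φ'} {σ : D.State Φ}
    (h : σ'.toLabeling.EqOff (plaquettePatch S p) σ.toLabeling) :
    σ'.restWeight p = σ.restWeight p := by
  have edge_eq (e : S.UEdge) (he : e ∈ univ.filter fun e : S.UEdge => p ∉ e.1) :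
      σ'.edge e.rep = σ.edge e.rep := by
    refine h.edge _ (plaquettePatch_avoidsEdge.mpr fun hp => (mem_filter.mp he).2 ?_)
    have mem_edge : p ∈ e.rep.edge := Sym2.mem_iff.mpr (hp.imp Eq.symm Eq.symm)
    rwa [e.edge_rep] at mem_edge
  have flagγ_eq (t : S.Face) (ht : t ∈ univ.filter fun t : S.Face => p ∉ t.1) :
      σ'.flagγ t.rep = σ.flagγ t.rep := by
    have avoids : (plaquettePatch S p).AvoidsFace t.rep.face :=
      plaquettePatch_avoidsFace.mpr (by rw [t.rep_face]; exact (mem_filter.mp ht).2)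
    have edge₁ : σ'.edge t.rep.e₁ = σ.edge t.rep.e₁ := h.edge _ avoids.avoidsEdge
    have edge₂ : σ'.edge t.rep.e₂ = σ.edge t.rep.e₂ := h.edge _ avoids.rotate.avoidsEdge
    have edge₃ : σ'.edge t.rep.e₃ = σ.edge t.rep.e₃ := h.edge _ avoids.rotate.rotate.avoidsEdge
    have vert_eq : σ'.vert t.rep.face = σ.vert t.rep.face := h.vert _ avoids
    rw [State.flagγ, State.flagγ, edge₁, edge₂, edge₃, vert_eq]
  rw [restWeight, restWeight, prod_congr rfl flagγ_eq,
    prod_congr rfl fun e he => congrArg D.β (edge_eq e he),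
    prod_congr rfl fun e he => congrArg D.d (edge_eq e he)]

theorem weight_mul_stringCoeff (p : V) (s : D.A) (σ' : D.State Φ') (σ : D.State Φ) :
    σ'.weight * D.stringCoeff p s σ' σ = star (D.stringCoeff p (D.dual s) σ σ') * σ.weight := by
  rw [stringCoeff_eq_ite, stringCoeff_eq_ite]
  by_cases h : σ'.toLabeling.EqOff (plaquettePatch S p) σ.toLabeling
  · rw [if_pos h, if_pos h.symm, σ'.weight_eq_mul p, σ.weight_eq_mul p, State.restWeight_congr h,
      mul_right_comm, boundaryWeight_mul_boundaryCoeff h, mul_assoc]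
  · rw [if_neg h, if_neg fun h' => h h'.symm, star_zero, mul_zero, zero_mul]

end Weight

section Form

variable {Φ Φ' : S.Coloring G}

theorem form_stringOp (p : V) (s : D.A) (ψ : D.StateSpace Φ') (φ : D.StateSpace Φ) :
    D.form ψ (D.stringOp p s Φ Φ' φ) = D.form (D.stringOp p (D.dual s) Φ' Φ ψ) φ := by
  simp only [form, stringOp, Matrix.mulVecLin_apply, Matrix.mulVec, dotProduct, Matrix.of_apply,
    star_sum, star_mul', mul_sum, sum_mul]
  rw [sum_comm]
  refine sum_congr rfl fun σ _ => sum_congr rfl fun σ' _ => ?_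
  linear_combination (star (ψ σ') * φ σ) * weight_mul_stringCoeff p s σ' σ

theorem form_sum_right {ι : Type*} (t : Finset ι) (ψ : D.StateSpace Φ) (φ : ι → D.StateSpace Φ)
    (c : ι → 𝕜) : D.form ψ (∑ i ∈ t, c i • φ i) = ∑ i ∈ t, c i * D.form ψ (φ i) := by
  simp only [form, Finset.sum_apply, Pi.smul_apply, smul_eq_mul, mul_sum]
  rw [sum_comm]
  exact sum_congr rfl fun i _ => sum_congr rfl fun σ _ => by ring

theorem form_sum_left {ι : Type*} (t : Finset ι) (ψ : ι → D.StateSpace Φ) (φ : D.StateSpace Φ)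
    (c : ι → 𝕜) : D.form (∑ i ∈ t, c i • ψ i) φ = ∑ i ∈ t, star (c i) * D.form (ψ i) φ := by
  simp only [form, Finset.sum_apply, Pi.smul_apply, smul_eq_mul, mul_sum, star_sum, star_mul',
    sum_mul]
  rw [sum_comm]
  exact sum_congr rfl fun i _ => sum_congr rfl fun σ _ => by ring

theorem form_gradedPlaquetteOp (p : V) (g : G) (ψ : D.StateSpace Φ') (φ : D.StateSpace Φ) :
    D.form ψ (D.gradedPlaquetteOp p g Φ Φ' φ) = D.form (D.gradedPlaquetteOp p (-g) Φ' Φ ψ) φ := by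
  unfold gradedPlaquetteOp
  rw [sum_I_dual]
  simp only [LinearMap.sum_apply, LinearMap.smul_apply, D.b_dual]
  rw [form_sum_right, form_sum_left]
  simp only [D.star_b, form_stringOp]

theorem form_plaquetteOp (p : V) (g : G) (ψ φ : D.StateSpace Φ) :
    D.form ψ (D.plaquetteOp Φ p g φ) = D.form (D.plaquetteOp Φ p g ψ) φ := by
  simp only [plaquetteOp, LinearMap.comp_apply, form_gradedPlaquetteOp, neg_neg]

end Form

end Adjoint

end LWData

/-- For each plaquette `p` there is a generic `g`; `B_p = B_p^g B_p^{-g}` does not depend on it;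
`B_p` is a projector; plaquette operators commute; they are Hermitian for the indefinite form. -/
theorem mainTheorem8 {𝕜 : Type*} [Field 𝕜] [StarRing 𝕜] {G : Type*} [AddCommGroup G]
    (D : LWData 𝕜 G) {V : Type*} [Fintype V] [DecidableEq V] (S : TriangulatedSurface V)
    (Φ : S.Coloring G) (hΦ : D.Admissible Φ) :
    (∀ p : V, ∃ g : G, D.GenericAt Φ p g) ∧
    (∀ (p : V) (g g' : G), D.GenericAt Φ p g → D.GenericAt Φ p g' →
      D.plaquetteOp Φ p g = D.plaquetteOp Φ p g') ∧
    (∀ (p : V) (g : G), D.GenericAt Φ p g →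
      D.plaquetteOp Φ p g * D.plaquetteOp Φ p g = D.plaquetteOp Φ p g) ∧
    (∀ (p p' : V) (g g' : G), D.GenericAt Φ p g → D.GenericAt Φ p' g' →
      D.plaquetteOp Φ p g * D.plaquetteOp Φ p' g' =
        D.plaquetteOp Φ p' g' * D.plaquetteOp Φ p g) ∧
    (∀ (p : V) (g : G), D.GenericAt Φ p g → ∀ ψ φ : D.StateSpace Φ,
      D.form ψ (D.plaquetteOp Φ p g φ) = D.form (D.plaquetteOp Φ p g ψ) φ) := by
  refine ⟨fun p => ?_, fun p g g' hg hg' => LWData.plaquetteOp_eq hΦ hg hg',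
    fun p g hg => LWData.plaquetteOp_mul_self hΦ hg,
    fun p p' g g' hg hg' => LWData.plaquetteOp_comm hΦ hg hg',
    fun p g _ ψ φ => LWData.form_plaquetteOp p g ψ φ⟩
  obtain ⟨g, hg, -⟩ := D.exists_genericAt hΦ hΦ p Set.finite_empty
  exact ⟨g, hg⟩
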